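/- **Theorem 3.3.** A *Gauss diagram with base point* is an oriented (counterclockwise) circle with a base point and finitely many chords with distinct endpoints away from the base point, each chord carrying a sign $\pm$ and an arrow (from the upper to the lower branch of the corresponding crossing), up to orientation- and base-point-preserving homeomorphism. A *long virtual knot* is an equivalence class of such diagrams under the Gauss diagram versions of the (oriented) Reidemeister moves performed away from the base point. For a diagram $D'$ with signed chords without arrows, a *state* $S$ is a choice of a positive or negative marker at every chord. Markers of the same sign as their chord give the smoothing that respects the orientation, the other markers give the other smoothing. Let $|S|$ be the number of circles obtained (the base point being ignored), $\sigma(S)$ the number of positive minus the number of negative markers, $w$ the sum of the signs of the chords, and $$V_{D'}(t)=(-1)^{w}\sum_S (t^{1/2})^{\,w+(w-\sigma(S))/2}\,\bigl(-t^{1/2}-t^{-1/2}\bigr)^{|S|-1}\in\mathbb Z[t^{1/2},t^{-1/2}].$$ For a Gauss diagram $D$ with base point let $p_r(D)$ be $D$ with the arrows forgotten and the signs kept. Let $p(D)$ be $D$ with arrows and signs replaced by types $a$, $b$: starting from the base point along the orientation, a chord has type $a$ if it is positive and first met at its tail or negative and first met at its head, and type $b$ otherwise. Let $i$ replace $a$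 by $+$ and $b$ by $-$. Put $V_D=V_{p_r(D)}$. Then $V_D$ and $V_{i(p(D))}$ depend only on the long virtual knot $K$ represented by $D$; they are denoted $V_K$ and $V_{i(p(K))}$. The pair $(V_K,V_{i(p(K))})$ is a strictly stronger invariant of long virtual knots than $V_K$ alone. Explicitly, let $K_1$ and $K_2$ be the long virtual knots given by the three-chord diagrams with Gauss word $0\,1\,0\,2\,1\,2$ (starting from the base point), with signs $-,+,-$ of the chords $0,1,2$, where all chords are first met at their tails for $K_1$, and all are first met at their heads for $K_2$. Then $$V_{K_1}(t)=V_{K_2}(t)=t^{-2}-t^{-1}-t^{-1/2}+1+t^{1/2},$$ while $$V_{i(p(K_1))}(t)=V_{K_1}(t)\neq V_{K_1}(t^{-1})=V_{K_2}(t^{-1})=V_{i(p(K_2))}(t).$$ -/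

import Mathlib

open scoped LaurentPolynomial

namespace LongVirtual

/-- A Gauss diagram with base point, read off along the line (equivalently, along the
counterclockwise circle starting from the base point).  Chords are labelled by natural numbers;
the letter `(c, true)` is the passage along the upper branch of the crossing `c` (the tail of the
arrow of the chord `c`) and `(c, false)` is the passage along its lower branch (the head of the
arrow).  `sign c` is the sign of the chord `c`; it is irrelevant if `c` does not occur. -/
structure GaussDiagram where
  word : List (ℕ × Bool)
  sign : ℕ → ℤˣ
  nodup : word.Nodup
  paired : ∀ c o, (c, o) ∈ word → (c, !o) ∈ word

/-- A chord diagram with base point whose chords carry a mark in `δ` and no arrow: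
every label that occurs occurs exactly twice. -/
structure ChordDiagram (δ : Type) where
  word : List ℕ
  mark : ℕ → δ
  double : ∀ c ∈ word, word.count c = 2

namespace GaussDiagram

/-- The signs of `H` agree with those of `G` on all chords of `G`. -/
def SignsExtend (G H : GaussDiagram) : Prop :=
  ∀ c o, (c, o) ∈ G.word → H.sign c = G.sign c

/-- The letters `x`, `y` in this order if `e = 1`, and in the other order if `e = -1`. -/
def ordered (e : ℤˣ) (x y : ℕ × Bool) : List (ℕ × Bool) :=
  if e = 1 then [x, y] else [y, x]

/-- The three branches of a triangle of a third Reidemeister move: `a` is the crossing of the top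
and middle branches, `b` of the top and bottom branches, `c` of the middle and bottom branches.
`e` is the order of the crossings on the top branch; the signs then force the orders on the other
two branches (as for three oriented straight lines in the oriented plane). -/
def branches (sign : ℕ → ℤˣ) (a b c : ℕ) (e : ℤˣ) : Fin 3 → List (ℕ × Bool) :=
  ![ordered e (a, true) (b, true),
    ordered (e * sign b * sign c) (a, false) (c, true),
    ordered (e * sign a * sign c) (b, false) (c, false)]

/-- Isomorphism of Gauss diagrams (change of labels) and the Reidemeister moves away from the base
point, in all their oriented versions. -/
inductive Move : GaussDiagram → GaussDiagram → Prop
  | relabel (G H : GaussDiagram) (f : ℕ ≃ ℕ)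
      (hw : H.word = G.word.map (fun x => (f x.1, x.2)))
      (hs : ∀ c o, (c, o) ∈ G.word → H.sign (f c) = G.sign c) : Move G H
  | omega1 (G H : GaussDiagram) (u v : List (ℕ × Bool)) (c : ℕ) (o : Bool)
      (hG : G.word = u ++ v) (hH : H.word = u ++ [(c, o), (c, !o)] ++ v)
      (hs : SignsExtend G H) : Move G H
  | omega2_direct (G H : GaussDiagram) (u v w : List (ℕ × Bool)) (c d : ℕ) (o : Bool)
      (hG : G.word = u ++ v ++ w)
      (hH : H.word = u ++ [(c, o), (d, o)] ++ v ++ [(c, !o), (d, !o)] ++ w)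
      (hs : SignsExtend G H) (hcd : H.sign d = -H.sign c) : Move G H
  | omega2_reverse (G H : GaussDiagram) (u v w : List (ℕ × Bool)) (c d : ℕ) (o : Bool)
      (hG : G.word = u ++ v ++ w)
      (hH : H.word = u ++ [(c, o), (d, o)] ++ v ++ [(d, !o), (c, !o)] ++ w)
      (hs : SignsExtend G H) (hcd : H.sign d = -H.sign c) : Move G H
  | omega3 (G H : GaussDiagram) (u₀ u₁ u₂ u₃ : List (ℕ × Bool)) (a b c : ℕ) (e : ℤˣ)
      (π : Equiv.Perm (Fin 3))
      (hG : G.word = u₀ ++ branches G.sign a b c e (π 0) ++ u₁ ++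
        branches G.sign a b c e (π 1) ++ u₂ ++ branches G.sign a b c e (π 2) ++ u₃)
      (hH : H.word = u₀ ++ branches G.sign a b c (-e) (π 0) ++ u₁ ++
        branches G.sign a b c (-e) (π 1) ++ u₂ ++ branches G.sign a b c (-e) (π 2) ++ u₃)
      (hs : SignsExtend G H) : Move G H

/-- Forgetting which letter is over and which is under leaves a word in which every chord occurs
twice. -/
theorem count_map_fst (G : GaussDiagram) (c : ℕ) (hc : c ∈ G.word.map Prod.fst) :
    (G.word.map Prod.fst).count c = 2 := by
  have key : ∀ l : List (ℕ × Bool),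
      (l.map Prod.fst).count c = l.count (c, true) + l.count (c, false) := by
    intro l
    induction l with
    | nil => simp
    | cons x l ih =>
      obtain ⟨d, o⟩ := x
      by_cases h : d = c
      · subst h
        cases o <;> simp [ih] <;> omega
      · simp [ih, h]
  obtain ⟨⟨d, o⟩, hm, rfl⟩ := List.mem_map.1 hc
  have h1 := G.paired d o hm
  have h2 := List.count_eq_one_of_mem G.nodup hm
  have h3 := List.count_eq_one_of_mem G.nodup h1
  rw [key]
  cases o <;> simp_all

end GaussDiagram

/-- Long virtual knots: Gauss diagrams with base point up to the equivalence relation generated by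
isomorphism and Reidemeister moves. -/
def LongVirtualKnot : Type := Quot GaussDiagram.Move

/-- The long virtual knot represented by a Gauss diagram with base point. -/
def GaussDiagram.knot (G : GaussDiagram) : LongVirtualKnot := Quot.mk _ G

/-- The projection `p_r`: neglect the directions of the arrows and keep the signs. -/
def pr (G : GaussDiagram) : ChordDiagram ℤˣ where
  word := G.word.map Prod.fst
  mark := G.sign
  double := G.count_map_fst

/-- The two types of double points of the curve underlying a long knot diagram. -/
inductive FlatType
  | a
  | b
  deriving DecidableEq

/-- Starting from the base point, the chord `c` is first met at its tail (on the upper branch). -/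
def GaussDiagram.FirstOver (G : GaussDiagram) (c : ℕ) : Prop :=
  G.word.idxOf (c, true) < G.word.idxOf (c, false)

open Classical in
/-- The projection `p` to open flat virtual knots: a chord gets type `a` if it is positive and
first met at its tail, or negative and first met at its head; otherwise it gets type `b`. -/
noncomputable def p (G : GaussDiagram) : ChordDiagram FlatType where
  word := G.word.map Prod.fst
  mark c := if (G.sign c = 1 ↔ G.FirstOver c) then FlatType.a else FlatType.b
  double := G.count_map_fst

/-- The map `i`: replace `a` by `+` and `b` by `-`. -/
def i (D : ChordDiagram FlatType) : ChordDiagram ℤˣ where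
  word := D.word
  mark c := if D.mark c = FlatType.a then 1 else -1
  double := D.double

namespace ChordDiagram

/-- The set of chords of a chord diagram. -/
def chords {δ : Type} (D : ChordDiagram δ) : Finset ℕ := D.word.toFinset

/-- The writhe: the number of positive chords minus the number of negative chords. -/
def writhe (D : ChordDiagram ℤˣ) : ℤ := ∑ c ∈ D.chords, (D.mark c : ℤ)

/-- The chord endpoints cut the line into `D.word.length + 1` arcs: the arc `k.castSucc` ends and
the arc `k.succ` starts at the `k`-th endpoint.  `Joined D s` says which arcs are glued in the
Kauffman state whose chords with positive marker (`A`-smoothing) are those in `s`.  The positive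
marker at a positive chord, and the negative marker at a negative chord, give the smoothing that
respects the orientation; the two other combinations give the other smoothing.  The first and the
last arc are glued, since the line is closed up to a circle through the base point. -/
inductive Joined (D : ChordDiagram ℤˣ) (s : Finset ℕ) :
    Fin (D.word.length + 1) → Fin (D.word.length + 1) → Prop
  | base : Joined D s 0 (Fin.last D.word.length)
  | oriented (k l : Fin D.word.length) (hkl : k ≠ l) (h : D.word.get k = D.word.get l)
      (ho : D.word.get k ∈ s ↔ D.mark (D.word.get k) = 1) : Joined D s k.castSucc l.succ
  | unoriented_in (k l : Fin D.word.length) (hkl : k ≠ l) (h : D.word.get k = D.word.get l)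
      (ho : ¬ (D.word.get k ∈ s ↔ D.mark (D.word.get k) = 1)) :
      Joined D s k.castSucc l.castSucc
  | unoriented_out (k l : Fin D.word.length) (hkl : k ≠ l) (h : D.word.get k = D.word.get l)
      (ho : ¬ (D.word.get k ∈ s ↔ D.mark (D.word.get k) = 1)) : Joined D s k.succ l.succ

/-- The number of circles of the Kauffman state `s`. -/
noncomputable def circles (D : ChordDiagram ℤˣ) (s : Finset ℕ) : ℕ := Nat.card (Quot (D.Joined s))

/-- The number of positive markers minus the number of negative markers of the state `s`. -/
def sigma (D : ChordDiagram ℤˣ) (s : Finset ℕ) : ℤ := (s.card : ℤ) - ((D.chords \ s).card : ℤ)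

/-- The Jones polynomial of a signed chord diagram as a Laurent polynomial in the variable
`T = t ^ (1 / 2)`.  With `w` the writhe, this is the Kauffman bracket state sum
`(-A ^ 3) ^ (-w) * ∑ s, A ^ σ(s) * (-A ^ 2 - A ^ (-2)) ^ (circles s - 1)` at `A ^ (-2) = T`:
`A ^ (σ - 3 * w)` is `T ^ (w + (w - σ) / 2)`, where the division is exact because `w` and `σ` are
both congruent modulo 2 to the number of chords. -/
noncomputable def jones (D : ChordDiagram ℤˣ) : ℤ[T;T⁻¹] :=
  (D.writhe.negOnePow : ℤ) •
    ∑ s ∈ D.chords.powerset,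
      LaurentPolynomial.T (D.writhe + (D.writhe - D.sigma s) / 2) *
        (-LaurentPolynomial.T 1 - LaurentPolynomial.T (-1)) ^ (D.circles s - 1)

end ChordDiagram

/-- The signs `-`, `+`, `-` of the chords `0`, `1`, `2`. -/
def exampleSign (c : ℕ) : ℤˣ := if c = 1 then 1 else -1

/-- The diagram with Gauss word `0 1 0 2 1 2` and signs `-`, `+`, `-`, every chord being first met
on its upper branch. -/
def diagram₁ : GaussDiagram where
  word := [(0, true), (1, true), (0, false), (2, true), (1, false), (2, false)]
  sign := exampleSign
  nodup := by decide
  paired := by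
    intro c o h
    simp only [List.mem_cons, Prod.mk.injEq, List.not_mem_nil, or_false] at h ⊢
    cases o <;> simp_all

/-- The diagram with Gauss word `0 1 0 2 1 2` and signs `-`, `+`, `-`, every chord being first met
on its lower branch. -/
def diagram₂ : GaussDiagram where
  word := [(0, false), (1, false), (0, true), (2, false), (1, true), (2, true)]
  sign := exampleSign
  nodup := by decide
  paired := by
    intro c o h
    simp only [List.mem_cons, Prod.mk.injEq, List.not_mem_nil, or_false] at h ⊢
    cases o <;> simp_all

/-- The two long virtual knots of the example. -/
def K₁ : LongVirtualKnot := diagram₁.knot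

/-- See `K₁`. -/
def K₂ : LongVirtualKnot := diagram₂.knot

end LongVirtual

/-!
# The Jones polynomials of the two projections of a long virtual knot

Smooth every chord either along or against the orientation.  In these terms the polynomial of a
signed chord diagram is `∏ (-T ^ μ)` times a state sum in which a smoothing along the orientation
has weight `1`, one against it has weight `T ^ μ`, and a circle has the value `-T - T⁻¹`
(`jones_eq_bracket`); half-integral exponents disappear, and the gluing of arcs in a state does not
depend on the signs.  Reversing all signs thus exchanges `T` and `T⁻¹` (`jones_neg`).

A state is an equivalence relation on the arcs, and its circles are the classes.  Chords may be
resolved one at a time (`stateSum_insert`), so that a Reidemeister move is a local identity for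
evaluations `R ↦ δ ^ (classes R - 1)` of relations `R` in which the arcs inside the move are still
isolated (`resolve_kink`, `resolve_bigon_direct`, `resolve_bigon_reverse`, `cross_triangle`).  All
counts in these identities reduce to one fact: attaching an isolated point to another point lowers
the number of classes by one (`classes_pendant`).  The moves that create letters also use that
cutting an arc and regluing it changes nothing (`stateSum_insert_pair`).

The third move holds for every triangle of signed chords that is the shadow of three lines at
different heights (`jones_triangle`).  The projection `i ∘ p` keeps the sign of a chord if its arrow
is first met at its tail and reverses it otherwise, that is, it makes all crossings descending
along the line.  Chords outside a move keep their behaviour, the two chords of a second move are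
reversed together, and in a third move the effect is to replace the heights of the three strands by
their order along the line (`jones_of_branches`).  Hence both projections are invariant
(`jones_move`).

In the example both diagrams have the same signed projection; `i ∘ p` keeps all signs of the first
and reverses all signs of the second, and the polynomial is not symmetric under `T ↦ T⁻¹`.
-/

namespace LongVirtual

open LaurentPolynomial (T T_add T_zero)

/-! ### Gluing points and counting classes -/

section Gluing

variable {V W : Type}

/-- The equivalence relation generated by the pairs in the list `L`. -/
def glue (L : List (V × V)) : Setoid V := Relation.EqvGen.setoid fun x y => (x, y) ∈ L

theorem glue_le_iff {L : List (V × V)} {S : Setoid V} :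
    glue L ≤ S ↔ ∀ e ∈ L, S e.1 e.2 := by
  constructor
  · intro h e he
    exact h (Relation.EqvGen.rel _ _ he)
  · intro h
    exact Setoid.eqvGen_le fun x y hxy => h (x, y) hxy

theorem glue_append (L L' : List (V × V)) : glue (L ++ L') = glue L ⊔ glue L' := by
  apply eq_of_forall_ge_iff
  intro S
  simp only [sup_le_iff, glue_le_iff, List.mem_append]
  exact ⟨fun h => ⟨fun e he => h e (.inl he), fun e he => h e (.inr he)⟩,
    fun h e he => he.elim (h.1 e) (h.2 e)⟩

/-- Two lists of pairs generate the same equivalence relation as soon as they impose equivalent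
systems of equations on every function.  This turns identities of setoids into problems for
congruence closure. -/
theorem glue_congr {L L' : List (V × V)}
    (h : ∀ (X : Type) (f : V → X), (∀ e ∈ L, f e.1 = f e.2) ↔ ∀ e ∈ L', f e.1 = f e.2) :
    glue L = glue L' := by
  apply eq_of_forall_ge_iff
  intro S
  have h1 := h (Quotient S) (Quotient.mk S)
  have h2 : ∀ x y : V, Quotient.mk S x = Quotient.mk S y ↔ S x y := fun x y => Quotient.eq
  simp only [h2] at h1
  rw [glue_le_iff, glue_le_iff, h1]

/-- The number of classes of an equivalence relation. -/
noncomputable def classes (R : Setoid V) : ℕ := Nat.card (Quotient R)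

/-- The coarsest equivalence relation in which `x` is alone in its class. -/
def apart (x : V) : Setoid V := Setoid.ker (· = x)

theorem apart_apply {x y z : V} : apart x y z ↔ (y = x ↔ z = x) := by
  change ((y = x) = (z = x)) ↔ _
  exact eq_iff_iff

theorem glue_le_apart {L : List (V × V)} {x : V} (h : ∀ e ∈ L, e.1 ≠ x ∧ e.2 ≠ x) :
    glue L ≤ apart x := by
  rw [glue_le_iff]
  intro e he
  simp [apart_apply, h e he]

/-- Attaching an isolated point to some other point lowers the number of classes by one. -/
theorem classes_pendant [Finite V] {R : Setoid V} {x p : V} (hR : R ≤ apart x) (hp : p ≠ x) :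
    classes (R ⊔ glue [(x, p)]) + 1 = classes R := by
  classical
  set S := R ⊔ glue [(x, p)] with hS
  have hxp : S x p := (le_sup_right : glue [(x, p)] ≤ S) (Relation.EqvGen.rel _ _ (by simp))
  have hback : ∀ {v w : V}, v ≠ x → w ≠ x → S v w → R v w := by
    have hle : S ≤ Setoid.comap (fun v => if v = x then p else v) R := by
      refine sup_le ?_ (glue_le_iff.2 ?_)
      · intro v w hvw
        have := apart_apply.1 (hR hvw)
        by_cases hv : v = x
        · have hw := this.1 hv
          simp [hv, hw]
        · have hw : w ≠ x := fun h => hv (this.2 h)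
          simpa [Setoid.comap_rel, hv, hw] using hvw
      · intro e he
        rw [List.mem_singleton.1 he, Setoid.comap_rel]
        simp [hp]
    intro v w hv hw h
    have := hle h
    simpa [Setoid.comap_rel, hv, hw] using this
  let g : V → Option (Quotient S) := fun v => if v = x then none else some (Quotient.mk S v)
  have hg : ∀ v w, R v w → g v = g w := by
    intro v w hvw
    have := apart_apply.1 (hR hvw)
    by_cases hv : v = x
    · simp [g, hv, this.1 hv]
    · have hw : w ≠ x := fun h => hv (this.2 h)
      simp only [g, hv, hw, if_false]
      exact congrArg some (Quotient.sound ((le_sup_left : R ≤ S) hvw))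
  let G : Quotient R → Option (Quotient S) := Quotient.lift g hg
  have hbij : Function.Bijective G := by
    constructor
    · intro a b
      induction a using Quotient.inductionOn with | _ v
      induction b using Quotient.inductionOn with | _ w
      intro h
      change g v = g w at h
      by_cases hv : v = x <;> by_cases hw : w = x
      · rw [hv, hw]
      · simp [g, hv, hw] at h
      · simp [g, hv, hw] at h
      · simp only [g, hv, hw, if_false, Option.some.injEq] at h
        exact Quotient.sound (hback hv hw (Quotient.exact h))
    · rintro (_ | b)
      · exact ⟨Quotient.mk R x, by simp [G, g]⟩
      · induction b using Quotient.inductionOn with | _ v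
        by_cases hv : v = x
        · refine ⟨Quotient.mk R p, ?_⟩
          change g p = _
          simp only [g, hp, if_false, Option.some.injEq]
          exact Quotient.sound (hv ▸ S.symm' hxp)
        · exact ⟨Quotient.mk R v, by simp [G, g, hv]⟩
  rw [classes, classes, Nat.card_eq_of_bijective G hbij, Finite.card_option]

theorem classes_pos [Finite V] [Nonempty V] (R : Setoid V) : 0 < classes R := by
  have : Nonempty (Quotient R) := Nonempty.map (Quotient.mk R) ‹_›
  exact Nat.card_pos

/-- Pulling a relation back along a surjection keeps the number of classes. -/
theorem classes_eq_of_surjective {f : V → W} (hf : Function.Surjective f)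
    {R : Setoid V} {S : Setoid W} (h : Setoid.comap f S = R) : classes R = classes S := by
  subst h
  refine Nat.card_congr ((Setoid.comapQuotientEquiv f S).trans ?_)
  exact (Equiv.setCongr (Set.range_eq_univ.2 (Quotient.mk''_surjective.comp hf))).trans
    (Equiv.Set.univ _)

/-- If a relation `s` on `W` is the image of a relation `r` on `V` under `f`, then the relation
generated by `s` pulls back to the one generated by `r` and the fibres of `f`. -/
theorem comap_eqvGen {f : V → W} (hf : Function.Surjective f) {r : V → V → Prop}
    {s : W → W → Prop} (h : ∀ x y, s x y ↔ ∃ a b, r a b ∧ f a = x ∧ f b = y) :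
    Setoid.comap f (Relation.EqvGen.setoid s) = Relation.EqvGen.setoid r ⊔ Setoid.ker f := by
  apply le_antisymm
  · set T := Relation.EqvGen.setoid r ⊔ Setoid.ker f with hT
    have hker : Setoid.ker f ≤ T := le_sup_right
    have key : Relation.EqvGen.setoid s ≤ T.mapOfSurjective f hker hf := by
      refine Setoid.eqvGen_le fun x y hxy => ?_
      obtain ⟨a, b, hab, rfl, rfl⟩ := (h x y).1 hxy
      exact ⟨a, b, (le_sup_left : _ ≤ T) (Relation.EqvGen.rel _ _ hab), rfl, rfl⟩
    intro a b hab
    obtain ⟨a', b', h', ha, hb⟩ := key hab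
    exact T.trans' (T.symm' (hker ha)) (T.trans' h' (hker hb))
  · refine sup_le (Setoid.eqvGen_le fun a b hab => ?_) fun a b hab => ?_
    · exact Relation.EqvGen.rel _ _ ((h _ _).2 ⟨a, b, hab, rfl, rfl⟩)
    · rw [Setoid.comap_rel, Setoid.ker_def.1 hab]

end Gluing

/-! ### State sums -/

section StateSum

variable {V : Type} {A : Type} [CommRing A]

/-- The gluing of the state in which exactly the chords of `O` get the smoothing `u`, the other
chords of `C` get the smoothing `o`, on top of a base relation `Q`. -/
def stateRel (o u : ℕ → Setoid V) (C : Finset ℕ) (Q : Setoid V) (O : Finset ℕ) : Setoid V :=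
  Q ⊔ C.sup fun c => if c ∈ O then u c else o c

/-- The state sum over the chords in `C`: every chord gets the smoothing `o` with weight `1` or
the smoothing `u` with weight `w`, and `F` evaluates the resulting relation. -/
def stateSum (o u : ℕ → Setoid V) (w : ℕ → A) (C : Finset ℕ) (F : Setoid V → A)
    (Q : Setoid V) : A :=
  ∑ O ∈ C.powerset, (∏ c ∈ O, w c) * F (stateRel o u C Q O)

/-- Resolving the chord `c`. -/
def resolve (o u : Setoid V) (w : A) (F : Setoid V → A) (R : Setoid V) : A :=
  F (R ⊔ o) + w * F (R ⊔ u)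

theorem stateSum_insert (o u : ℕ → Setoid V) (w : ℕ → A) {C : Finset ℕ} {c : ℕ} (hc : c ∉ C)
    (F : Setoid V → A) (Q : Setoid V) :
    stateSum o u w (insert c C) F Q = stateSum o u w C (resolve (o c) (u c) (w c) F) Q := by
  unfold stateSum
  rw [Finset.sum_powerset_insert hc, ← Finset.sum_add_distrib]
  refine Finset.sum_congr rfl fun O hO => ?_
  have hcO : c ∉ O := fun h => hc (Finset.mem_powerset.1 hO h)
  have e1 : stateRel o u (insert c C) Q O = stateRel o u C Q O ⊔ o c := by
    simp only [stateRel, Finset.sup_insert, hcO, if_false]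
    rw [sup_comm (o c), sup_assoc]
  have e2 : stateRel o u (insert c C) Q (insert c O) = stateRel o u C Q O ⊔ u c := by
    simp only [stateRel, Finset.sup_insert, Finset.mem_insert_self, if_true]
    rw [sup_comm (u c), sup_assoc]
    congr 2
    refine Finset.sup_congr rfl fun d hd => ?_
    have : d ≠ c := fun h => hc (h ▸ hd)
    simp [this]
  rw [e1, e2, Finset.prod_insert hcO, resolve]
  ring

/-- Two state sums agree if they have the same smoothings and weights and the evaluations agree on
all relations finer than a relation `K` that is coarser than everything in sight. -/
theorem stateSum_congr {o u o' u' : ℕ → Setoid V} {w w' : ℕ → A} {C : Finset ℕ}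
    {F F' : Setoid V → A} {Q : Setoid V} (K : Setoid V)
    (ho : ∀ c ∈ C, o c = o' c) (hu : ∀ c ∈ C, u c = u' c) (hw : ∀ c ∈ C, w c = w' c)
    (hQ : Q ≤ K) (hoK : ∀ c ∈ C, o c ≤ K) (huK : ∀ c ∈ C, u c ≤ K)
    (hF : ∀ R ≤ K, F R = F' R) :
    stateSum o u w C F Q = stateSum o' u' w' C F' Q := by
  refine Finset.sum_congr rfl fun O hO => ?_
  have e : stateRel o u C Q O = stateRel o' u' C Q O := by
    unfold stateRel
    congr 1
    refine Finset.sup_congr rfl fun c hc => ?_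
    rw [ho c hc, hu c hc]
  rw [← e, hF, Finset.prod_congr rfl fun c hc => hw c (Finset.mem_powerset.1 hO hc)]
  refine sup_le hQ (Finset.sup_le fun c hc => ?_)
  split_ifs
  exacts [huK c hc, hoK c hc]

theorem stateSum_sup (o u : ℕ → Setoid V) (w : ℕ → A) (C : Finset ℕ) (F : Setoid V → A)
    (Q E : Setoid V) :
    stateSum o u w C F (Q ⊔ E) = stateSum o u w C (fun R => F (R ⊔ E)) Q := by
  refine Finset.sum_congr rfl fun O _ => ?_
  simp only [stateRel]
  rw [sup_right_comm]

theorem map_stateSum {B : Type} [CommRing B] (φ : A →+* B) (o u : ℕ → Setoid V) (w : ℕ → A)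
    (C : Finset ℕ) (F : Setoid V → A) (Q : Setoid V) :
    φ (stateSum o u w C F Q) = stateSum o u (fun c => φ (w c)) C (fun R => φ (F R)) Q := by
  simp [stateSum, map_sum, map_prod]

end StateSum

/-! ### Local relations of the state sum -/

section Local

variable {V A : Type} [CommRing A]

/-- The contribution of the circles of a state, `δ ^ (number of circles - 1)`; the subtraction is
exact, as there is always a class. -/
noncomputable def loops (δ : A) (R : Setoid V) : A := δ ^ (classes R - 1)

/-- Attaching the first entries of the pairs in `P`, one after the other, to the second entries,
each of them being isolated beforehand. -/
theorem classes_pendants [Finite V] (P : List (V × V)) {R : Setoid V}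
    (hP : P.Pairwise fun e e' => e'.1 ≠ e.1 ∧ e.2 ≠ e'.1)
    (hR : ∀ e ∈ P, e.2 ≠ e.1 ∧ R ≤ apart e.1) :
    classes (R ⊔ glue P) + P.length = classes R := by
  induction P generalizing R with
  | nil =>
    have : glue ([] : List (V × V)) ≤ R := glue_le_iff.2 (by simp)
    rw [sup_eq_left.2 this]
    rfl
  | cons e P ih =>
    have h1 := hR e (by simp)
    rw [List.pairwise_cons] at hP
    have h2 : glue (e :: P) = glue [e] ⊔ glue P := glue_append [e] P
    have h3 := ih (R := R ⊔ glue [e]) hP.2 fun e' he' =>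
      ⟨(hR e' (by simp [he'])).1, sup_le (hR e' (by simp [he'])).2 (glue_le_apart (by
        have := hP.1 e' he'
        simp [this.1.symm, this.2]))⟩
    have h4 := classes_pendant (R := R) (x := e.1) (p := e.2) h1.2 h1.1
    rw [h2, ← sup_assoc, List.length_cons, ← add_assoc, h3]
    exact h4

/-- If the gluings `L` amount to the gluings `M` of other points together with attaching the
isolated points that are the first entries of `P`, the latter may be dropped from the count. -/
theorem classes_eliminate [Finite V] {R : Setoid V} {L : List (V × V)} (M P : List (V × V))
    (h : ∀ (X : Type) (f : V → X),
      (∀ e ∈ L, f e.1 = f e.2) ↔ ∀ e ∈ M ++ P, f e.1 = f e.2)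
    (hP : P.Pairwise fun e e' => e'.1 ≠ e.1 ∧ e.2 ≠ e'.1)
    (hR : ∀ e ∈ P, e.2 ≠ e.1 ∧ R ≤ apart e.1 ∧ ∀ e' ∈ M, e'.1 ≠ e.1 ∧ e'.2 ≠ e.1) :
    classes (R ⊔ glue L) + P.length = classes (R ⊔ glue M) := by
  rw [glue_congr h, glue_append, ← sup_assoc]
  refine classes_pendants P hP fun e he => ⟨(hR e he).1, sup_le (hR e he).2.1 ?_⟩
  exact glue_le_apart (hR e he).2.2

/-- `classes_eliminate` for the contribution of the circles. -/
theorem loops_eliminate [Finite V] (δ : A) {R : Setoid V} {L : List (V × V)}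
    (M P : List (V × V))
    (h : ∀ (X : Type) (f : V → X),
      (∀ e ∈ L, f e.1 = f e.2) ↔ ∀ e ∈ M ++ P, f e.1 = f e.2)
    (hP : P.Pairwise fun e e' => e'.1 ≠ e.1 ∧ e.2 ≠ e'.1)
    (hR : ∀ e ∈ P, e.2 ≠ e.1 ∧ R ≤ apart e.1 ∧ ∀ e' ∈ M, e'.1 ≠ e.1 ∧ e'.2 ≠ e.1) :
    loops δ (R ⊔ glue L) = δ ^ (classes (R ⊔ glue M) - (P.length + 1)) := by
  have := classes_eliminate M P h hP hR
  rw [loops]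
  congr 1
  omega

/-- The local relation for the first Reidemeister move: the chord has adjacent ends, `m` is the arc
between them and `α`, `β` are the arcs before and after.  The smoothing that respects the
orientation splits off the circle `m`. -/
theorem resolve_kink [Finite V] [Nonempty V] (δ w : A) {R : Setoid V} {α m β : V}
    (hm : R ≤ apart m) (hα : α ≠ m) (hβ : β ≠ m) :
    resolve (glue [(α, β), (m, m)]) (glue [(α, m), (m, β)]) w (loops δ) R =
      (δ + w) * loops δ (R ⊔ glue [(α, m), (m, β)]) := by
  have h := classes_eliminate (R := R) (L := [(α, m), (m, β)]) [(α, β)] [(m, α)]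
    (by intro X f; simp; grind) (by simp) (by simp [*])
  have h0 : glue [(α, β), (m, m)] = glue [(α, β)] := glue_congr (by intro X f; simp)
  have hpos := classes_pos (R ⊔ glue [(α, m), (m, β)])
  have h1 : classes (R ⊔ glue [(α, β)]) - 1 = classes (R ⊔ glue [(α, m), (m, β)]) - 1 + 1 := by
    simp at h
    omega
  rw [resolve, loops, loops, h0, h1]
  ring

/-- The local relation for the second Reidemeister move with strands in the same direction.  The
strands are `α m β` and `γ n ε`.  The oriented state gives the two uncrossed strands, up to
exchanging `m` and `n`, and the other three states, one of which contains a small circle, cancel. -/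
theorem resolve_bigon_direct [Finite V] [Nonempty V] (δ w w' : A) (hw : w * w' = 1)
    (hδ : w + w' + δ = 0) {R : Setoid V} {α m β γ n ε : V}
    (hm : R ≤ apart m) (hn : R ≤ apart n) (hmn : m ≠ n) (h1 : α ≠ m) (h2 : β ≠ m) (h3 : γ ≠ m)
    (h4 : ε ≠ m) (h5 : α ≠ n) (h6 : β ≠ n) (h7 : γ ≠ n) (h8 : ε ≠ n) :
    resolve (glue [(m, ε), (n, β)]) (glue [(m, n), (β, ε)]) w'
      (resolve (glue [(α, n), (γ, m)]) (glue [(α, γ), (m, n)]) w (loops δ)) R =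
      loops δ (R ⊔ glue [(α, m), (m, β), (γ, n), (n, ε)]) := by
  have hnm := hmn.symm
  have a1 := classes_eliminate (R := R) (L := [(α, m), (m, β), (γ, n), (n, ε)])
    [(α, β), (γ, ε)] [(m, α), (n, γ)] (by intro X f; simp; grind) (by simp [*]) (by simp [*])
  have a2 := classes_eliminate (R := R) (L := [(m, ε), (n, β)] ++ [(α, n), (γ, m)])
    [(α, β), (γ, ε)] [(n, α), (m, γ)] (by intro X f; simp; grind) (by simp [*]) (by simp [*])
  have a3 := classes_eliminate (R := R) (L := [(m, ε), (n, β)] ++ [(α, γ), (m, n)])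
    [(α, γ), (β, ε)] [(n, β), (m, β)] (by intro X f; simp; grind) (by simp [*]) (by simp [*])
  have a4 := classes_eliminate (R := R) (L := [(m, n), (β, ε)] ++ [(α, n), (γ, m)])
    [(α, γ), (β, ε)] [(n, α), (m, α)] (by intro X f; simp; grind) (by simp [*]) (by simp [*])
  have a5 := classes_eliminate (R := R) (L := [(m, n), (β, ε)] ++ [(α, γ), (m, n)])
    [(α, γ), (β, ε)] [(n, m)] (by intro X f; simp; grind) (by simp [*]) (by simp [*])
  have p1 := classes_pos (R ⊔ glue ([(m, ε), (n, β)] ++ [(α, γ), (m, n)]))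
  simp only [List.length_cons, List.length_nil] at a1 a2 a3 a4 a5
  simp only [resolve, loops, sup_assoc, ← glue_append]
  rw [show classes (R ⊔ glue ([(m, ε), (n, β)] ++ [(α, n), (γ, m)])) =
      classes (R ⊔ glue [(α, m), (m, β), (γ, n), (n, ε)]) by omega,
    show classes (R ⊔ glue ([(m, n), (β, ε)] ++ [(α, n), (γ, m)])) =
      classes (R ⊔ glue ([(m, ε), (n, β)] ++ [(α, γ), (m, n)])) by omega,
    show classes (R ⊔ glue ([(m, n), (β, ε)] ++ [(α, γ), (m, n)])) - 1 =
      classes (R ⊔ glue ([(m, ε), (n, β)] ++ [(α, γ), (m, n)])) - 1 + 1 by omega]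
  linear_combination
    δ ^ (classes (R ⊔ glue ([(m, ε), (n, β)] ++ [(α, γ), (m, n)])) - 1) * (hδ + δ * hw)

/-- The local relation for the second Reidemeister move with strands in opposite directions.  Here
the state without any oriented smoothing gives the uncrossed strands, and the oriented one contains
the small circle. -/
theorem resolve_bigon_reverse [Finite V] [Nonempty V] (δ w w' : A) (hw : w * w' = 1)
    (hδ : w + w' + δ = 0) {R : Setoid V} {α m β γ n ε : V}
    (hm : R ≤ apart m) (hn : R ≤ apart n) (hmn : m ≠ n) (h1 : α ≠ m) (h2 : β ≠ m) (h3 : γ ≠ m)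
    (h4 : ε ≠ m) (h5 : α ≠ n) (h6 : β ≠ n) (h7 : γ ≠ n) (h8 : ε ≠ n) :
    resolve (glue [(m, n), (γ, β)]) (glue [(m, γ), (β, n)]) w'
      (resolve (glue [(α, ε), (n, m)]) (glue [(α, n), (m, ε)]) w (loops δ)) R =
      loops δ (R ⊔ glue [(α, m), (m, β), (γ, n), (n, ε)]) := by
  have hnm := hmn.symm
  have a1 := classes_eliminate (R := R) (L := [(α, m), (m, β), (γ, n), (n, ε)])
    [(α, β), (γ, ε)] [(m, α), (n, γ)] (by intro X f; simp; grind) (by simp [*]) (by simp [*])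
  have a2 := classes_eliminate (R := R) (L := [(m, γ), (β, n)] ++ [(α, n), (m, ε)])
    [(α, β), (γ, ε)] [(n, α), (m, γ)] (by intro X f; simp; grind) (by simp [*]) (by simp [*])
  have a3 := classes_eliminate (R := R) (L := [(m, n), (γ, β)] ++ [(α, n), (m, ε)])
    [(α, ε), (γ, β)] [(n, α), (m, α)] (by intro X f; simp; grind) (by simp [*]) (by simp [*])
  have a4 := classes_eliminate (R := R) (L := [(m, γ), (β, n)] ++ [(α, ε), (n, m)])
    [(α, ε), (γ, β)] [(n, β), (m, β)] (by intro X f; simp; grind) (by simp [*]) (by simp [*])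
  have a5 := classes_eliminate (R := R) (L := [(m, n), (γ, β)] ++ [(α, ε), (n, m)])
    [(α, ε), (γ, β)] [(n, m)] (by intro X f; simp; grind) (by simp [*]) (by simp [*])
  have p1 := classes_pos (R ⊔ glue ([(m, n), (γ, β)] ++ [(α, n), (m, ε)]))
  simp only [List.length_cons, List.length_nil] at a1 a2 a3 a4 a5
  simp only [resolve, loops, sup_assoc, ← glue_append]
  rw [show classes (R ⊔ glue ([(m, γ), (β, n)] ++ [(α, n), (m, ε)])) =
      classes (R ⊔ glue [(α, m), (m, β), (γ, n), (n, ε)]) by omega,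
    show classes (R ⊔ glue ([(m, γ), (β, n)] ++ [(α, ε), (n, m)])) =
      classes (R ⊔ glue ([(m, n), (γ, β)] ++ [(α, n), (m, ε)])) by omega,
    show classes (R ⊔ glue ([(m, n), (γ, β)] ++ [(α, ε), (n, m)])) - 1 =
      classes (R ⊔ glue ([(m, n), (γ, β)] ++ [(α, n), (m, ε)])) - 1 + 1 by omega]
  linear_combination
    δ ^ (classes (R ⊔ glue ([(m, n), (γ, β)] ++ [(α, n), (m, ε)])) - 1) * hδ +
    δ ^ (classes (R ⊔ glue [(α, m), (m, β), (γ, n), (n, ε)]) - 1) * hw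

/-- Resolving the crossing of two strands `x₀ x₁` and `y₀ y₁`, with weight `a` for the smoothing
that respects these directions and `b` for the other one.  As both weights are free, the strands
may be traversed in either direction. -/
def cross (x₀ x₁ y₀ y₁ : V) (a b : A) (F : Setoid V → A) (R : Setoid V) : A :=
  a * F (R ⊔ glue [(x₀, y₁), (x₁, y₀)]) + b * F (R ⊔ glue [(x₀, y₀), (x₁, y₁)])

/-- The local relation for the third Reidemeister move.  The three strands are
`x₀ x₁ x₂`, `y₀ y₁ y₂` and `z₀ z₁ z₂`; on the left the strands `x`, `y` meet first on both of them,
`x`, `z` meet last on `x` and first on `z`, and `y`, `z` meet last on both of them.  On the right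
all these orders are reversed.  Each side has eight states, one of which contains a small circle;
they sort into five matchings of the six outer points.  Three of them have the same coefficient on
both sides, and the hypothesis `hab` equates the coefficients of the other two. -/
theorem cross_triangle [Finite V] [Nonempty V] (δ a b a' b' a'' b'' : A)
    (hab : b * a' * a'' + a * a' * b'' + b * a' * b'' * δ + b * b' * b'' = a * b' * a'')
    {R : Setoid V} {x₀ x₁ x₂ y₀ y₁ y₂ z₀ z₁ z₂ : V}
    (hx : R ≤ apart x₁) (hy : R ≤ apart y₁) (hz : R ≤ apart z₁)
    (hxy : x₁ ≠ y₁) (hxz : x₁ ≠ z₁) (hyz : y₁ ≠ z₁)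
    (hout : ∀ v ∈ [x₀, x₂, y₀, y₂, z₀, z₂], v ≠ x₁ ∧ v ≠ y₁ ∧ v ≠ z₁) :
    cross y₁ y₂ z₁ z₂ a'' b''
        (cross x₁ x₂ z₀ z₁ a' b' (cross x₀ x₁ y₀ y₁ a b (loops δ))) R =
      cross y₀ y₁ z₀ z₁ a'' b''
        (cross x₀ x₁ z₁ z₂ a' b' (cross x₁ x₂ y₁ y₂ a b (loops δ))) R := by
  have hyx := hxy.symm
  have hzx := hxz.symm
  have hzy := hyz.symm
  simp only [List.forall_mem_cons, List.not_mem_nil, false_implies, implies_true, and_true] at hout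
  obtain ⟨⟨_, _, _⟩, ⟨_, _, _⟩, ⟨_, _, _⟩, ⟨_, _, _⟩, ⟨_, _, _⟩, ⟨_, _, _⟩⟩ := hout
  -- the states containing a small circle have two inner points left to attach
  have n_g := classes_eliminate (R := R)
    (L := [(y₁, z₁), (y₂, z₂)] ++ [(x₁, z₀), (x₂, z₁)] ++ [(x₀, y₀), (x₁, y₁)])
    [(x₀, y₀), (x₂, z₀), (y₂, z₂)] [(x₁, x₂), (y₁, x₂), (z₁, x₂)]
    (by intro X f; simp; grind) (by simp [*]) (by simp [*])
  have n_h := classes_eliminate (R := R)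
    (L := [(y₀, z₀), (y₁, z₁)] ++ [(x₀, z₁), (x₁, z₂)] ++ [(x₁, y₁), (x₂, y₂)])
    [(x₂, y₂), (x₀, z₂), (y₀, z₀)] [(x₁, x₀), (y₁, x₀), (z₁, x₀)]
    (by intro X f; simp; grind) (by simp [*]) (by simp [*])
  have p_g := classes_pos
    (R ⊔ glue ([(y₁, z₁), (y₂, z₂)] ++ [(x₁, z₀), (x₂, z₁)] ++ [(x₀, y₀), (x₁, y₁)]))
  have p_h := classes_pos
    (R ⊔ glue ([(y₀, z₀), (y₁, z₁)] ++ [(x₀, z₁), (x₁, z₂)] ++ [(x₁, y₁), (x₂, y₂)]))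
  -- the states on both sides: `o` or `u` for the smoothings of the crossings of the strands
  -- `x`, `y`, of `x`, `z` and of `y`, `z`
  have g_ooo := loops_eliminate δ (R := R)
    (L := [(y₁, z₂), (y₂, z₁)] ++ [(x₁, z₁), (x₂, z₀)] ++ [(x₀, y₁), (x₁, y₀)])
    [(x₀, z₂), (y₀, y₂), (x₂, z₀)] [(x₁, y₀), (y₁, x₀), (z₁, y₀)]
    (by intro X f; simp; grind) (by simp [*]) (by simp [*])
  have g_uoo := loops_eliminate δ (R := R)
    (L := [(y₁, z₂), (y₂, z₁)] ++ [(x₁, z₁), (x₂, z₀)] ++ [(x₀, y₀), (x₁, y₁)])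
    [(x₀, y₀), (x₂, z₀), (y₂, z₂)] [(x₁, y₂), (y₁, y₂), (z₁, y₂)]
    (by intro X f; simp; grind) (by simp [*]) (by simp [*])
  have g_ouo := loops_eliminate δ (R := R)
    (L := [(y₁, z₂), (y₂, z₁)] ++ [(x₁, z₀), (x₂, z₁)] ++ [(x₀, y₁), (x₁, y₀)])
    [(x₂, y₂), (x₀, z₂), (y₀, z₀)] [(x₁, y₀), (y₁, x₀), (z₁, x₂)]
    (by intro X f; simp; grind) (by simp [*]) (by simp [*])
  have g_oou := loops_eliminate δ (R := R)
    (L := [(y₁, z₁), (y₂, z₂)] ++ [(x₁, z₁), (x₂, z₀)] ++ [(x₀, y₁), (x₁, y₀)])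
    [(x₀, y₀), (x₂, z₀), (y₂, z₂)] [(x₁, x₀), (y₁, x₀), (z₁, x₀)]
    (by intro X f; simp; grind) (by simp [*]) (by simp [*])
  have g_uuo := loops_eliminate δ (R := R)
    (L := [(y₁, z₂), (y₂, z₁)] ++ [(x₁, z₀), (x₂, z₁)] ++ [(x₀, y₀), (x₁, y₁)])
    [(x₀, y₀), (z₀, z₂), (x₂, y₂)] [(x₁, z₀), (y₁, z₀), (z₁, x₂)]
    (by intro X f; simp; grind) (by simp [*]) (by simp [*])
  have g_uou := loops_eliminate δ (R := R)
    (L := [(y₁, z₁), (y₂, z₂)] ++ [(x₁, z₁), (x₂, z₀)] ++ [(x₀, y₀), (x₁, y₁)])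
    [(x₀, y₀), (x₂, z₀), (y₂, z₂)] [(y₁, x₁), (z₁, x₁)]
    (by intro X f; simp; grind) (by simp [*]) (by simp [*])
  have g_ouu := loops_eliminate δ (R := R)
    (L := [(y₁, z₁), (y₂, z₂)] ++ [(x₁, z₀), (x₂, z₁)] ++ [(x₀, y₁), (x₁, y₀)])
    [(x₀, x₂), (y₀, z₀), (y₂, z₂)] [(x₁, y₀), (y₁, x₀), (z₁, x₀)]
    (by intro X f; simp; grind) (by simp [*]) (by simp [*])
  have g_uuu := loops_eliminate δ (R := R)
    (L := [(y₁, z₁), (y₂, z₂)] ++ [(x₁, z₀), (x₂, z₁)] ++ [(x₀, y₀), (x₁, y₁)])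
    [(x₀, y₀), (x₂, z₀), (y₂, z₂)] [(x₁, x₂), (y₁, x₂), (z₁, x₂)]
    (by intro X f; simp; grind) (by simp [*]) (by simp [*])
  have h_ooo := loops_eliminate δ (R := R)
    (L := [(y₀, z₁), (y₁, z₀)] ++ [(x₀, z₂), (x₁, z₁)] ++ [(x₁, y₂), (x₂, y₁)])
    [(x₀, z₂), (y₀, y₂), (x₂, z₀)] [(x₁, y₀), (y₁, x₂), (z₁, y₀)]
    (by intro X f; simp; grind) (by simp [*]) (by simp [*])
  have h_uoo := loops_eliminate δ (R := R)
    (L := [(y₀, z₁), (y₁, z₀)] ++ [(x₀, z₂), (x₁, z₁)] ++ [(x₁, y₁), (x₂, y₂)])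
    [(x₂, y₂), (x₀, z₂), (y₀, z₀)] [(x₁, y₀), (y₁, y₀), (z₁, y₀)]
    (by intro X f; simp; grind) (by simp [*]) (by simp [*])
  have h_ouo := loops_eliminate δ (R := R)
    (L := [(y₀, z₁), (y₁, z₀)] ++ [(x₀, z₁), (x₁, z₂)] ++ [(x₁, y₂), (x₂, y₁)])
    [(x₀, y₀), (x₂, z₀), (y₂, z₂)] [(x₁, y₂), (y₁, x₂), (z₁, x₀)]
    (by intro X f; simp; grind) (by simp [*]) (by simp [*])
  have h_oou := loops_eliminate δ (R := R)
    (L := [(y₀, z₀), (y₁, z₁)] ++ [(x₀, z₂), (x₁, z₁)] ++ [(x₁, y₂), (x₂, y₁)])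
    [(x₂, y₂), (x₀, z₂), (y₀, z₀)] [(x₁, y₂), (y₁, y₂), (z₁, y₂)]
    (by intro X f; simp; grind) (by simp [*]) (by simp [*])
  have h_uuo := loops_eliminate δ (R := R)
    (L := [(y₀, z₁), (y₁, z₀)] ++ [(x₀, z₁), (x₁, z₂)] ++ [(x₁, y₁), (x₂, y₂)])
    [(x₀, y₀), (z₀, z₂), (x₂, y₂)] [(x₁, z₀), (y₁, z₀), (z₁, x₀)]
    (by intro X f; simp; grind) (by simp [*]) (by simp [*])
  have h_uou := loops_eliminate δ (R := R)
    (L := [(y₀, z₀), (y₁, z₁)] ++ [(x₀, z₂), (x₁, z₁)] ++ [(x₁, y₁), (x₂, y₂)])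
    [(x₂, y₂), (x₀, z₂), (y₀, z₀)] [(y₁, x₁), (z₁, x₁)]
    (by intro X f; simp; grind) (by simp [*]) (by simp [*])
  have h_ouu := loops_eliminate δ (R := R)
    (L := [(y₀, z₀), (y₁, z₁)] ++ [(x₀, z₁), (x₁, z₂)] ++ [(x₁, y₂), (x₂, y₁)])
    [(x₀, x₂), (y₀, z₀), (y₂, z₂)] [(x₁, y₂), (y₁, x₀), (z₁, x₀)]
    (by intro X f; simp; grind) (by simp [*]) (by simp [*])
  have h_uuu := loops_eliminate δ (R := R)
    (L := [(y₀, z₀), (y₁, z₁)] ++ [(x₀, z₁), (x₁, z₂)] ++ [(x₁, y₁), (x₂, y₂)])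
    [(x₂, y₂), (x₀, z₂), (y₀, z₀)] [(x₁, x₀), (y₁, x₀), (z₁, x₀)]
    (by intro X f; simp; grind) (by simp [*]) (by simp [*])
  simp only [List.length_cons, List.length_nil, Nat.reduceAdd] at *
  rw [show classes (R ⊔ glue [(x₀, y₀), (x₂, z₀), (y₂, z₂)]) - 3 =
    classes (R ⊔ glue [(x₀, y₀), (x₂, z₀), (y₂, z₂)]) - 4 + 1 by omega, pow_succ] at g_uou
  rw [show classes (R ⊔ glue [(x₂, y₂), (x₀, z₂), (y₀, z₀)]) - 3 =
    classes (R ⊔ glue [(x₂, y₂), (x₀, z₂), (y₀, z₀)]) - 4 + 1 by omega, pow_succ] at h_uou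
  simp only [cross, sup_assoc, ← glue_append]
  rw [g_ooo, g_uoo, g_ouo, g_oou, g_uuo, g_uou, g_ouu, g_uuu,
    h_ooo, h_uoo, h_ouo, h_oou, h_uuo, h_uou, h_ouu, h_uuu]
  linear_combination
    (δ ^ (classes (R ⊔ glue [(x₀, y₀), (x₂, z₀), (y₂, z₂)]) - 4) -
      δ ^ (classes (R ⊔ glue [(x₂, y₂), (x₀, z₂), (y₀, z₀)]) - 4)) * hab

end Local

/-! ### Smoothings of a word -/

section Words

/-- The gluing of arcs by the orientation-respecting smoothing of the chord `c` of the word `w`.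
The arc with number `k` ends, and the arc with number `k + 1` starts, at the `k`-th letter. -/
def orient (N : ℕ) (w : List ℕ) (c : ℕ) : Setoid (Fin (N + 1)) :=
  Relation.EqvGen.setoid fun x y => ∃ k l : ℕ, k ≠ l ∧ w[k]? = some c ∧ w[l]? = some c ∧
    x.val = k ∧ y.val = l + 1

/-- The gluing of arcs by the other smoothing of the chord `c` of the word `w`. -/
def disorient (N : ℕ) (w : List ℕ) (c : ℕ) : Setoid (Fin (N + 1)) :=
  Relation.EqvGen.setoid fun x y => ∃ k l : ℕ, k ≠ l ∧ w[k]? = some c ∧ w[l]? = some c ∧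
    (x.val = k ∧ y.val = l ∨ x.val = k + 1 ∧ y.val = l + 1)

theorem orient_eq_glue {N : ℕ} {w : List ℕ} {c k l : ℕ} (hkl : k ≠ l)
    (h : ∀ m, w[m]? = some c ↔ m = k ∨ m = l) {x x' y y' : Fin (N + 1)} (hx : x.val = k)
    (hx' : x'.val = k + 1) (hy : y.val = l) (hy' : y'.val = l + 1) :
    orient N w c = glue [(x, y'), (y, x')] := by
  apply le_antisymm
  · refine Setoid.eqvGen_le ?_
    rintro a b ⟨m, n, hmn, hm, hn, ha, hb⟩
    rw [h] at hm hn
    refine Relation.EqvGen.rel _ _ ?_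
    simp only [List.mem_cons, Prod.mk.injEq, List.not_mem_nil, or_false, Fin.ext_iff]
    omega
  · rw [glue_le_iff]
    intro e he
    simp only [List.mem_cons, List.not_mem_nil, or_false] at he
    refine Relation.EqvGen.rel _ _ ?_
    rcases he with rfl | rfl
    · exact ⟨k, l, hkl, (h k).2 (.inl rfl), (h l).2 (.inr rfl), hx, hy'⟩
    · exact ⟨l, k, hkl.symm, (h l).2 (.inr rfl), (h k).2 (.inl rfl), hy, hx'⟩

theorem disorient_eq_glue {N : ℕ} {w : List ℕ} {c k l : ℕ} (hkl : k ≠ l)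
    (h : ∀ m, w[m]? = some c ↔ m = k ∨ m = l) {x x' y y' : Fin (N + 1)} (hx : x.val = k)
    (hx' : x'.val = k + 1) (hy : y.val = l) (hy' : y'.val = l + 1) :
    disorient N w c = glue [(x, y), (x', y')] := by
  apply le_antisymm
  · refine Setoid.eqvGen_le ?_
    rintro a b ⟨m, n, hmn, hm, hn, hab⟩
    rw [h] at hm hn
    have key : (a = x ∧ b = y ∨ a = x' ∧ b = y') ∨ (b = x ∧ a = y ∨ b = x' ∧ a = y') := by
      simp only [Fin.ext_iff]
      omega
    rcases key with key | key
    · refine Relation.EqvGen.rel _ _ ?_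
      simpa using key
    · refine Relation.EqvGen.symm _ _ (Relation.EqvGen.rel _ _ ?_)
      simpa using key
  · rw [glue_le_iff]
    intro e he
    simp only [List.mem_cons, List.not_mem_nil, or_false] at he
    refine Relation.EqvGen.rel _ _ ⟨k, l, hkl, (h k).2 (.inl rfl), (h l).2 (.inr rfl), ?_⟩
    rcases he with rfl | rfl
    · exact .inl ⟨hx, hy⟩
    · exact .inr ⟨hx', hy'⟩

theorem orient_le_apart {N : ℕ} {w : List ℕ} {c k : ℕ} {x : Fin (N + 1)} (hx : x.val = k + 1)
    (h : w[k]? ≠ some c) (h' : w[k + 1]? ≠ some c) : orient N w c ≤ apart x := by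
  refine Setoid.eqvGen_le ?_
  rintro a b ⟨m, n, -, hm, hn, ha, hb⟩
  have h1 : a ≠ x := by
    rintro rfl
    exact h' (by rwa [← hx, ha])
  have h2 : b ≠ x := by
    rintro rfl
    exact h (by rwa [show k = n by omega])
  simp [apart_apply, h1, h2]

theorem disorient_le_apart {N : ℕ} {w : List ℕ} {c k : ℕ} {x : Fin (N + 1)} (hx : x.val = k + 1)
    (h : w[k]? ≠ some c) (h' : w[k + 1]? ≠ some c) : disorient N w c ≤ apart x := by
  refine Setoid.eqvGen_le ?_
  rintro a b ⟨m, n, -, hm, hn, hab⟩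
  have e1 : ∀ j, w[j]? = some c → j ≠ k ∧ j ≠ k + 1 := fun j hj =>
    ⟨fun e => h (e ▸ hj), fun e => h' (e ▸ hj)⟩
  have h1 := e1 m hm
  have h2 := e1 n hn
  rw [apart_apply, Fin.ext_iff, Fin.ext_iff]
  omega

theorem orient_congr {N : ℕ} {w w' : List ℕ} {c : ℕ}
    (h : ∀ m : ℕ, w[m]? = some c ↔ w'[m]? = some c) : orient N w c = orient N w' c := by
  simp only [orient, h]

theorem disorient_congr {N : ℕ} {w w' : List ℕ} {c : ℕ}
    (h : ∀ m : ℕ, w[m]? = some c ↔ w'[m]? = some c) : disorient N w c = disorient N w' c := by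
  simp only [disorient, h]

theorem card_positions (w : List ℕ) (c : ℕ) :
    ((Finset.range w.length).filter fun m => w[m]? = some c).card = w.count c := by
  induction w using List.reverseRecOn with
  | nil => simp
  | append_singleton w a ih =>
    have h : ((Finset.range w.length).filter fun m => (w ++ [a])[m]? = some c) =
        (Finset.range w.length).filter fun m => w[m]? = some c := by
      refine Finset.filter_congr fun m hm => ?_
      rw [List.getElem?_append_left (Finset.mem_range.1 hm)]
    rw [List.length_append, List.length_singleton, Finset.range_add_one, Finset.filter_insert, h,
      List.count_append, List.count_singleton, ← ih]
    by_cases hac : a = c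
    · simp [hac]
    · simp [hac]

/-- A letter that occurs twice occurs at no position but the two known ones. -/
theorem getElem?_iff_of_count {w : List ℕ} {c k l : ℕ} (h : w.count c = 2) (hkl : k ≠ l)
    (hk : w[k]? = some c) (hl : w[l]? = some c) (m : ℕ) :
    w[m]? = some c ↔ m = k ∨ m = l := by
  have hlt : ∀ j, w[j]? = some c → j < w.length := fun j hj =>
    (List.getElem?_eq_some_iff.1 hj).1
  have hsub : ({k, l} : Finset ℕ) ⊆ (Finset.range w.length).filter fun m => w[m]? = some c := by
    intro j hj
    simp only [Finset.mem_insert, Finset.mem_singleton] at hj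
    rcases hj with rfl | rfl
    · exact Finset.mem_filter.2 ⟨Finset.mem_range.2 (hlt _ hk), hk⟩
    · exact Finset.mem_filter.2 ⟨Finset.mem_range.2 (hlt _ hl), hl⟩
  have heq := Finset.eq_of_subset_of_card_le hsub (by
    rw [card_positions, h, Finset.card_pair hkl])
  constructor
  · intro hm
    have : m ∈ ({k, l} : Finset ℕ) := by
      rw [heq]
      exact Finset.mem_filter.2 ⟨Finset.mem_range.2 (hlt _ hm), hm⟩
    simpa using this
  · rintro (rfl | rfl) <;> assumption

end Words

/-! ### Inserting two letters into a word -/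

section Insertion

/-- If the base relation and the smoothings are given by generators, so is the relation of a
state. -/
theorem stateRel_eqvGen {V : Type} (o u : ℕ → V → V → Prop) (q : V → V → Prop) (C O : Finset ℕ) :
    stateRel (fun c => Relation.EqvGen.setoid (o c)) (fun c => Relation.EqvGen.setoid (u c)) C
        (Relation.EqvGen.setoid q) O =
      Relation.EqvGen.setoid fun x y =>
        q x y ∨ ∃ c ∈ C, (c ∈ O ∧ u c x y) ∨ (c ∉ O ∧ o c x y) := by
  apply le_antisymm
  · refine sup_le (Setoid.eqvGen_mono fun x y h => .inl h) (Finset.sup_le fun c hc => ?_)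
    split_ifs with hO
    · exact Setoid.eqvGen_mono fun x y h => .inr ⟨c, hc, .inl ⟨hO, h⟩⟩
    · exact Setoid.eqvGen_mono fun x y h => .inr ⟨c, hc, .inr ⟨hO, h⟩⟩
  · refine Setoid.eqvGen_le ?_
    rintro x y (h | ⟨c, hc, h⟩)
    · exact (le_sup_left : Relation.EqvGen.setoid q ≤ _) (Relation.EqvGen.rel _ _ h)
    · have hle : (if c ∈ O then Relation.EqvGen.setoid (u c) else Relation.EqvGen.setoid (o c)) ≤
          stateRel (fun c => Relation.EqvGen.setoid (o c))
            (fun c => Relation.EqvGen.setoid (u c)) C (Relation.EqvGen.setoid q) O :=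
        le_sup_of_le_right (Finset.le_sup
          (f := fun c => if c ∈ O then Relation.EqvGen.setoid (u c)
            else Relation.EqvGen.setoid (o c)) hc)
      apply hle
      rcases h with ⟨hO, h⟩ | ⟨hO, h⟩
      · rw [if_pos hO]
        exact Relation.EqvGen.rel _ _ h
      · rw [if_neg hO]
        exact Relation.EqvGen.rel _ _ h

/-- The map of arcs that merges the arcs `i`, `i + 1`, `i + 2`. -/
def collapse {N i : ℕ} (hi : i ≤ N) (x : Fin (N + 2 + 1)) : Fin (N + 1) :=
  ⟨if x.val ≤ i then x.val else if x.val ≤ i + 2 then i else x.val - 2, by split_ifs <;> omega⟩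

theorem collapse_surjective {N i : ℕ} (hi : i ≤ N) : Function.Surjective (collapse hi) := by
  intro y
  refine ⟨⟨if y.val ≤ i then y.val else y.val + 2, by split_ifs <;> omega⟩, Fin.ext ?_⟩
  simp only [collapse]
  split_ifs <;> omega

/-- The gluings of the consecutive arcs `i`, `i + 1`, `i + 2`. -/
def consecutive {N i : ℕ} (hi : i ≤ N) : List (Fin (N + 2 + 1) × Fin (N + 2 + 1)) :=
  [(⟨i, by omega⟩, ⟨i + 1, by omega⟩), (⟨i + 1, by omega⟩, ⟨i + 2, by omega⟩)]

theorem ker_collapse {N i : ℕ} (hi : i ≤ N) :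
    Setoid.ker (collapse hi) = glue (consecutive hi) := by
  set E := glue (consecutive hi) with hE
  apply le_antisymm
  · have h1 : E ⟨i, by omega⟩ ⟨i + 1, by omega⟩ := Relation.EqvGen.rel _ _ (by simp [consecutive])
    have h2 : E ⟨i + 1, by omega⟩ ⟨i + 2, by omega⟩ :=
      Relation.EqvGen.rel _ _ (by simp [consecutive])
    have key : ∀ x : Fin (N + 2 + 1), i ≤ x.val → x.val ≤ i + 2 → E ⟨i, by omega⟩ x := by
      intro x hx hx'
      have : x.val = i ∨ x.val = i + 1 ∨ x.val = i + 2 := by omega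
      rcases this with h | h | h
      · rw [show x = ⟨i, by omega⟩ from Fin.ext h]
      · rwa [show x = ⟨i + 1, by omega⟩ from Fin.ext h]
      · rw [show x = ⟨i + 2, by omega⟩ from Fin.ext h]
        exact E.trans' h1 h2
    intro x y hxy
    rw [Setoid.ker_def, Fin.ext_iff] at hxy
    simp only [collapse] at hxy
    by_cases hxy' : x = y
    · rw [hxy']
    · rw [Fin.ext_iff] at hxy'
      refine E.trans' (E.symm' (key x ?_ ?_)) (key y ?_ ?_) <;> split_ifs at hxy <;> omega
  · rw [glue_le_iff]
    simp only [consecutive, List.forall_mem_cons, List.not_mem_nil, false_implies, implies_true,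
      and_true, Setoid.ker_def, Fin.ext_iff, collapse]
    constructor <;> split_ifs <;> omega

/-- A chord that does not end at the two inserted letters `a`, `b` keeps its ends, up to the shift
of positions. -/
theorem getElem?_insert_pair (u v : List ℕ) {a b c : ℕ} (ha : c ≠ a) (hb : c ≠ b) (m : ℕ) :
    (u ++ [a, b] ++ v)[m]? = some c ↔
      ∃ k, m = (if k < u.length then k else k + 2) ∧ (u ++ v)[k]? = some c := by
  have h0 : ∀ k, (u ++ [a, b] ++ v)[if k < u.length then k else k + 2]? = (u ++ v)[k]? := by
    intro k
    split_ifs with hk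
    · rw [List.append_assoc, List.getElem?_append_left hk, List.getElem?_append_left hk]
    · rw [List.getElem?_append_right (by simp; omega), List.getElem?_append_right (by omega)]
      congr 1
      simp only [List.length_append, List.length_cons, List.length_nil]
      omega
  constructor
  · intro h
    by_cases h1 : m < u.length
    · refine ⟨m, by simp [h1], ?_⟩
      rw [← h0, if_pos h1, h]
    · by_cases h2 : m < u.length + 2
      · exfalso
        rw [List.append_assoc, List.getElem?_append_right (by omega),
          List.getElem?_append_left (by simp; omega)] at h
        have h3 : m - u.length = 0 ∨ m - u.length = 1 := by omega
        rcases h3 with h3 | h3 <;> simp [h3] at h <;> omega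
      · have h3 : ¬ (m - 2 < u.length) := by omega
        refine ⟨m - 2, by simp [h3]; omega, ?_⟩
        rw [← h0, if_neg h3, ← h]
        congr 1
        omega
  · rintro ⟨k, rfl, hk⟩
    rw [h0, hk]

/-- Inserting two letters into a word and regluing the arc that they cut does not change a state
sum over other chords. -/
theorem stateSum_insert_pair {A : Type} [CommRing A] {N : ℕ} (u v : List ℕ) (hu : u.length ≤ N)
    (a b : ℕ) {C : Finset ℕ} (ha : a ∉ C) (hb : b ∉ C) (t : ℕ → A) (δ : A)
    (L : List (Fin (N + 2 + 1) × Fin (N + 2 + 1))) :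
    stateSum (orient N (u ++ v)) (disorient N (u ++ v)) t C (loops δ)
        (glue (L.map (Prod.map (collapse hu) (collapse hu)))) =
      stateSum (orient (N + 2) (u ++ [a, b] ++ v)) (disorient (N + 2) (u ++ [a, b] ++ v)) t C
        (loops δ) (glue L ⊔ glue (consecutive hu)) := by
  rw [stateSum_sup, ← ker_collapse hu]
  refine Finset.sum_congr rfl fun O _ => ?_
  congr 1
  -- the offsets `d`, `d'` distinguish the arc ending at a letter from the one starting there
  have key : ∀ c ∈ C, ∀ x y : Fin (N + 1), ∀ d d' : ℕ, d ≤ 1 → d' ≤ 1 →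
      ((∃ k l : ℕ, k ≠ l ∧ (u ++ v)[k]? = some c ∧ (u ++ v)[l]? = some c ∧
        x.val = k + d ∧ y.val = l + d') ↔
      ∃ x' y' : Fin (N + 2 + 1), (∃ k l : ℕ, k ≠ l ∧ (u ++ [a, b] ++ v)[k]? = some c ∧
        (u ++ [a, b] ++ v)[l]? = some c ∧ x'.val = k + d ∧ y'.val = l + d') ∧
        collapse hu x' = x ∧ collapse hu y' = y) := by
    intro c hc x y d d' hd hd'
    have hca : c ≠ a := fun h => ha (h ▸ hc)
    have hcb : c ≠ b := fun h => hb (h ▸ hc)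
    simp only [getElem?_insert_pair u v hca hcb]
    constructor
    · rintro ⟨k, l, hkl, hk, hl, hx, hy⟩
      refine ⟨⟨(if k < u.length then k else k + 2) + d, by split_ifs <;> omega⟩,
        ⟨(if l < u.length then l else l + 2) + d', by split_ifs <;> omega⟩,
        ⟨_, _, ?_, ⟨k, rfl, hk⟩, ⟨l, rfl, hl⟩, rfl, rfl⟩, Fin.ext ?_, Fin.ext ?_⟩
      · split_ifs <;> omega
      · simp only [collapse]
        split_ifs <;> omega
      · simp only [collapse]
        split_ifs <;> omega
    · rintro ⟨x', y', ⟨_, _, hkl, ⟨k, rfl, hk⟩, ⟨l, rfl, hl⟩, hx, hy⟩, rfl, rfl⟩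
      refine ⟨k, l, fun h => hkl (by rw [h]), hk, hl, ?_, ?_⟩
      · simp only [collapse]
        split_ifs at * <;> omega
      · simp only [collapse]
        split_ifs at * <;> omega
  simp only [loops]
  rw [classes_eq_of_surjective (collapse_surjective hu) ?_]
  unfold orient disorient glue
  rw [stateRel_eqvGen, stateRel_eqvGen]
  refine comap_eqvGen (collapse_surjective hu) fun x y => ?_
  constructor
  · rintro (h | ⟨c, hc, ⟨hO, h⟩ | ⟨hO, h⟩⟩)
    · obtain ⟨⟨x', y'⟩, h1, h2⟩ := List.mem_map.1 h
      rw [Prod.map_apply, Prod.mk.injEq] at h2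
      exact ⟨x', y', .inl h1, h2⟩
    · obtain ⟨k, l, hkl, hk, hl, hxy | hxy⟩ := h
      · obtain ⟨x', y', ⟨k', l', h1, h2, h3, h4⟩, h5⟩ := (key c hc x y 0 0 (by omega)
          (by omega)).1 ⟨k, l, hkl, hk, hl, hxy⟩
        exact ⟨x', y', .inr ⟨c, hc, .inl ⟨hO, k', l', h1, h2, h3, .inl h4⟩⟩, h5⟩
      · obtain ⟨x', y', ⟨k', l', h1, h2, h3, h4⟩, h5⟩ := (key c hc x y 1 1 (by omega)
          (by omega)).1 ⟨k, l, hkl, hk, hl, hxy⟩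
        exact ⟨x', y', .inr ⟨c, hc, .inl ⟨hO, k', l', h1, h2, h3, .inr h4⟩⟩, h5⟩
    · obtain ⟨x', y', h4, h5⟩ := (key c hc x y 0 1 (by omega) (by omega)).1 h
      exact ⟨x', y', .inr ⟨c, hc, .inr ⟨hO, h4⟩⟩, h5⟩
  · rintro ⟨x', y', h | ⟨c, hc, ⟨hO, k, l, h1, h2, h3, h4 | h4⟩ | ⟨hO, h⟩⟩, rfl, rfl⟩
    · exact .inl (List.mem_map.2 ⟨(x', y'), h, rfl⟩)
    · obtain ⟨k', l', h1', h2', h3', h4'⟩ := (key c hc _ _ 0 0 (by omega) (by omega)).2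
        ⟨x', y', ⟨k, l, h1, h2, h3, h4⟩, rfl, rfl⟩
      exact .inr ⟨c, hc, .inl ⟨hO, k', l', h1', h2', h3', .inl h4'⟩⟩
    · obtain ⟨k', l', h1', h2', h3', h4'⟩ := (key c hc _ _ 1 1 (by omega) (by omega)).2
        ⟨x', y', ⟨k, l, h1, h2, h3, h4⟩, rfl, rfl⟩
      exact .inr ⟨c, hc, .inl ⟨hO, k', l', h1', h2', h3', .inr h4'⟩⟩
    · exact .inr ⟨c, hc, .inr ⟨hO, (key c hc _ _ 0 1 (by omega) (by omega)).2
        ⟨x', y', h, rfl, rfl⟩⟩⟩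

end Insertion

/-! ### The Jones polynomial as a state sum -/

section Jones

/-- The value of a circle. -/
noncomputable def circleValue : ℤ[T;T⁻¹] := -T 1 - T (-1)

/-- The state sum of the word `w` with `N` letters over the chords in `C`, with signs `μ`: the
smoothing that respects the orientation has weight `1` and the other one has weight `T ^ μ`. -/
noncomputable def bracket (N : ℕ) (w : List ℕ) (μ : ℕ → ℤˣ) (C : Finset ℕ)
    (Q : Setoid (Fin (N + 1))) : ℤ[T;T⁻¹] :=
  stateSum (orient N w) (disorient N w) (fun c => T (μ c : ℤ)) C (loops circleValue) Q

/-- The pair of the first and the last arc, which are joined through the base point. -/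
def baseLoop (N : ℕ) : List (Fin (N + 1) × Fin (N + 1)) := [(0, Fin.last N)]

theorem T_sum (s : Finset ℕ) (f : ℕ → ℤ) : (T (∑ c ∈ s, f c) : ℤ[T;T⁻¹]) = ∏ c ∈ s, T (f c) := by
  induction s using Finset.cons_induction with
  | empty => simp
  | cons a s ha ih => rw [Finset.sum_cons, Finset.prod_cons, T_add, ih]

theorem negOnePow_writhe (s : Finset ℕ) (μ : ℕ → ℤˣ) :
    (((∑ c ∈ s, (μ c : ℤ)).negOnePow : ℤˣ) : ℤ) = ∏ _c ∈ s, (-1 : ℤ) := by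
  induction s using Finset.cons_induction with
  | empty => simp
  | cons a s ha ih =>
    rw [Finset.sum_cons, Finset.prod_cons, Int.negOnePow_add, Units.val_mul, ih]
    congr 1
    rcases Int.units_eq_one_or (μ a) with h | h <;> simp [h, Int.negOnePow_neg]

/-- The circles of the Kauffman state with positive markers at `s` are the classes of the state in
which the chords with marker different from their sign are smoothed against the orientation. -/
theorem circles_eq_classes (D : ChordDiagram ℤˣ) (s : Finset ℕ) :
    D.circles s = classes (stateRel (orient D.word.length D.word)
      (disorient D.word.length D.word) D.chords (glue (baseLoop D.word.length))
      (D.chords.filter fun c => ¬ (c ∈ s ↔ D.mark c = 1))) := by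
  have h1 : D.circles s = classes (Relation.EqvGen.setoid (D.Joined s)) :=
    Nat.card_congr
      { toFun := Quot.lift (Quotient.mk _) fun a b h =>
          Quotient.sound (Relation.EqvGen.rel _ _ h)
        invFun := Quotient.lift (Quot.mk _) fun a b h => Quot.eqvGen_sound h
        left_inv := by rintro ⟨x⟩; rfl
        right_inv := by rintro ⟨x⟩; rfl }
  rw [h1]
  congr 1
  unfold orient disorient glue
  rw [stateRel_eqvGen]
  have hmem : ∀ {k : ℕ} {c : ℕ}, D.word[k]? = some c → c ∈ D.chords := fun h =>
    List.mem_toFinset.2 (List.mem_of_getElem? h)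
  have hO : ∀ c ∈ D.chords, (c ∈ D.chords.filter fun c => ¬ (c ∈ s ↔ D.mark c = 1)) ↔
      ¬ (c ∈ s ↔ D.mark c = 1) := fun c hc => by rw [Finset.mem_filter, and_iff_right hc]
  have hget : ∀ k : Fin D.word.length, D.word[k.val]? = some (D.word.get k) := fun k => by simp
  congr 1
  ext x y
  constructor
  · intro h
    cases h with
    | base => exact .inl (by simp [baseLoop])
    | oriented k l hkl h ho =>
      exact .inr ⟨D.word.get k, hmem (hget k), .inr ⟨by rw [hO _ (hmem (hget k))]; exact not_not.2 ho,
        k, l, fun e => hkl (Fin.ext e), hget k, h ▸ hget l, rfl, rfl⟩⟩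
    | unoriented_in k l hkl h ho =>
      exact .inr ⟨D.word.get k, hmem (hget k), .inl ⟨by rwa [hO _ (hmem (hget k))],
        k, l, fun e => hkl (Fin.ext e), hget k, h ▸ hget l, .inl ⟨rfl, rfl⟩⟩⟩
    | unoriented_out k l hkl h ho =>
      exact .inr ⟨D.word.get k, hmem (hget k), .inl ⟨by rwa [hO _ (hmem (hget k))],
        k, l, fun e => hkl (Fin.ext e), hget k, h ▸ hget l, .inr ⟨rfl, rfl⟩⟩⟩
  · have hfin : ∀ {k c : ℕ}, D.word[k]? = some c →
        ∃ k' : Fin D.word.length, k'.val = k ∧ D.word.get k' = c := by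
      intro k c h
      obtain ⟨h1, h2⟩ := List.getElem?_eq_some_iff.1 h
      exact ⟨⟨k, h1⟩, rfl, h2⟩
    rintro (h | ⟨c, hc, ⟨hcO, k, l, hkl, hk, hl, hxy⟩ | ⟨hcO, k, l, hkl, hk, hl, hx, hy⟩⟩)
    · simp only [baseLoop, List.mem_singleton, Prod.mk.injEq] at h
      rw [h.1, h.2]
      exact .base
    · rw [hO c hc] at hcO
      obtain ⟨k, rfl, rfl⟩ := hfin hk
      obtain ⟨l, rfl, hkl'⟩ := hfin hl
      rcases hxy with ⟨hx, hy⟩ | ⟨hx, hy⟩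
      · rw [show x = k.castSucc from Fin.ext hx, show y = l.castSucc from Fin.ext hy]
        exact .unoriented_in k l (fun e => hkl (by rw [e])) hkl'.symm hcO
      · rw [show x = k.succ from Fin.ext hx, show y = l.succ from Fin.ext hy]
        exact .unoriented_out k l (fun e => hkl (by rw [e])) hkl'.symm hcO
    · rw [hO c hc, not_not] at hcO
      obtain ⟨k, rfl, rfl⟩ := hfin hk
      obtain ⟨l, rfl, hkl'⟩ := hfin hl
      rw [show x = k.castSucc from Fin.ext hx, show y = l.succ from Fin.ext hy]
      exact .oriented k l (fun e => hkl (by rw [e])) hkl'.symm hcO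

/-- The Jones polynomial in terms of the smoothings that respect the orientation and those that do
not: the half-integral exponents disappear, every chord contributes the factor `-T ^ μ`, and its
smoothing against the orientation another factor `T ^ μ`. -/
theorem jones_eq_bracket (D : ChordDiagram ℤˣ) {N : ℕ} {w : List ℕ} (hw : D.word = w)
    (hN : w.length = N) :
    D.jones = (∏ c ∈ D.chords, -T (D.mark c : ℤ)) *
      bracket N w D.mark D.chords (glue (baseLoop N)) := by
  subst hw hN
  have hpre : ∏ c ∈ D.chords, -(T (D.mark c : ℤ) : ℤ[T;T⁻¹]) =
      ((D.writhe.negOnePow : ℤˣ) : ℤ) • T D.writhe := by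
    rw [ChordDiagram.writhe, negOnePow_writhe, T_sum, zsmul_eq_mul, Int.cast_prod,
      ← Finset.prod_mul_distrib]
    simp
  rw [hpre, smul_mul_assoc, ChordDiagram.jones]
  congr 1
  rw [bracket, stateSum, Finset.mul_sum]
  -- passing from positive markers to smoothings against the orientation is an involution
  let O : Finset ℕ → Finset ℕ := fun s => D.chords.filter fun c => ¬ (c ∈ s ↔ D.mark c = 1)
  have hO : ∀ s ∈ D.chords.powerset, O s ∈ D.chords.powerset := fun s _ =>
    Finset.mem_powerset.2 (Finset.filter_subset _ _)
  have hOO : ∀ s ∈ D.chords.powerset, O (O s) = s := by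
    intro s hs
    ext c
    have : c ∈ s → c ∈ D.chords := fun h => Finset.mem_powerset.1 hs h
    simp only [O, Finset.mem_filter]
    tauto
  refine Finset.sum_nbij' O O hO hO hOO hOO fun s hs => ?_
  have hexp : D.writhe - D.sigma s = 2 * ∑ c ∈ O s, (D.mark c : ℤ) := by
    have hσ : D.sigma s = ∑ c ∈ D.chords, (if c ∈ s then (1 : ℤ) else -1) := by
      have h1 : s = D.chords.filter (· ∈ s) := by
        ext c
        have : c ∈ s → c ∈ D.chords := fun h => Finset.mem_powerset.1 hs h
        simp only [Finset.mem_filter]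
        tauto
      have h2 : D.chords \ s = D.chords.filter (· ∉ s) := by
        ext c
        simp
      rw [Finset.sum_ite, ChordDiagram.sigma, h2]
      nth_rewrite 1 [h1]
      simp
      ring
    rw [hσ, ChordDiagram.writhe, ← Finset.sum_sub_distrib, Finset.sum_filter, Finset.mul_sum]
    refine Finset.sum_congr rfl fun c _ => ?_
    rcases Int.units_eq_one_or (D.mark c) with h | h <;> by_cases hc : c ∈ s <;> simp [h, hc]
  rw [hexp, Int.mul_ediv_cancel_left _ two_ne_zero, T_add, T_sum, mul_assoc, circles_eq_classes]
  rfl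

/-- Reversing all signs replaces `T` by `T⁻¹`. -/
theorem jones_neg {D D' : ChordDiagram ℤˣ} (hw : D'.word = D.word)
    (hm : ∀ c ∈ D.word, D'.mark c = -D.mark c) : D'.jones = LaurentPolynomial.invert D.jones := by
  have hC : D'.chords = D.chords := by rw [ChordDiagram.chords, hw]; rfl
  have hm' : ∀ c ∈ D.chords, D'.mark c = -D.mark c := fun c hc => hm c (List.mem_toFinset.1 hc)
  rw [jones_eq_bracket D rfl rfl, jones_eq_bracket D' hw rfl, map_mul, map_prod, hC]
  congr 1
  · refine Finset.prod_congr rfl fun c hc => ?_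
    simp [hm' c hc]
  · unfold bracket
    have := map_stateSum (LaurentPolynomial.invert (R := ℤ)).toRingEquiv.toRingHom
      (orient D.word.length D.word) (disorient D.word.length D.word)
      (fun c => T (D.mark c : ℤ)) D.chords (loops circleValue) (glue (baseLoop D.word.length))
    refine Eq.trans ?_ this.symm
    refine stateSum_congr ⊤ (fun _ _ => rfl) (fun _ _ => rfl) ?_ le_top (fun _ _ => le_top)
      (fun _ _ => le_top) fun R _ => ?_
    · intro c hc
      simp [hm' c hc]
    · simp [loops, circleValue]
      congr 1
      ring

/-- Only the marks at the chords matter. -/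
theorem jones_congr {D D' : ChordDiagram ℤˣ} (hw : D'.word = D.word)
    (hm : ∀ c ∈ D.word, D'.mark c = D.mark c) : D'.jones = D.jones := by
  have hC : D'.chords = D.chords := by rw [ChordDiagram.chords, hw]; rfl
  have hm' : ∀ c ∈ D.chords, D'.mark c = D.mark c := fun c hc => hm c (List.mem_toFinset.1 hc)
  rw [jones_eq_bracket D rfl rfl, jones_eq_bracket D' hw rfl, hC]
  congr 1
  · exact Finset.prod_congr rfl fun c hc => by rw [hm' c hc]
  · exact stateSum_congr ⊤ (fun _ _ => rfl) (fun _ _ => rfl) (fun c hc => by rw [hm' c hc]) le_top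
      (fun _ _ => le_top) (fun _ _ => le_top) fun R _ => rfl

end Jones

/-! ### Invariance of the Jones polynomial under local moves of chord diagrams -/

section Moves

theorem chords_of_perm {D D' : ChordDiagram ℤˣ} {l : List ℕ} (h : List.Perm D'.word (l ++ D.word)) :
    D'.chords = l.toFinset ∪ D.chords := by
  rw [ChordDiagram.chords, List.toFinset_eq_of_perm _ _ h, List.toFinset_append]
  rfl

/-- A letter that accounts for both its occurrences in `l` is not a chord of the rest. -/
theorem not_mem_chords_of_perm {D D' : ChordDiagram ℤˣ} {l : List ℕ} {c : ℕ}
    (h : List.Perm D'.word (l ++ D.word)) (hc : 2 ≤ l.count c) : c ∉ D.chords := by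
  intro hmem
  have h1 : c ∈ D.word := List.mem_toFinset.1 hmem
  have h2 := D'.double c (h.mem_iff.2 (by simp [h1]))
  rw [h.count_eq, List.count_append] at h2
  have := D.double c h1
  omega

theorem glue_map_baseLoop {N i : ℕ} (hi : i ≤ N) :
    (baseLoop (N + 2)).map (Prod.map (collapse hi) (collapse hi)) = baseLoop N := by
  simp only [baseLoop, List.map_cons, List.map_nil, Prod.map_apply, List.cons.injEq,
    Prod.mk.injEq, and_true]
  refine ⟨Fin.ext ?_, Fin.ext ?_⟩
  · simp [collapse]
  · simp only [collapse, Fin.val_last]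
    split_ifs <;> omega

theorem baseLoop_le_apart {N : ℕ} {x : Fin (N + 1)} (h0 : 0 < x.val) (hN : x.val < N) :
    glue (baseLoop N) ≤ apart x := by
  refine glue_le_apart ?_
  simp only [baseLoop, List.mem_singleton, forall_eq, ne_eq, Fin.ext_iff, Fin.val_zero,
    Fin.val_last]
  omega

theorem getElem?_ne_some_of_append {w u v : List ℕ} {a b c : ℕ} (hw : w = u ++ ([a, b] ++ v)) (ha : c ≠ a)
    (hb : c ≠ b) : w[u.length]? ≠ some c ∧ w[u.length + 1]? ≠ some c := by
  subst hw
  simp [ha.symm, hb.symm]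

theorem getElem?_of_append_pair {w u v : List ℕ} {a b i : ℕ} (hw : w = u ++ ([a, b] ++ v))
    (hi : i = u.length) : w[i]? = some a ∧ w[i + 1]? = some b := by
  subst hw hi
  simp

theorem stateSum_const_mul {V A : Type} [CommRing A] (o u : ℕ → Setoid V) (w : ℕ → A)
    (C : Finset ℕ) (k : A) (F : Setoid V → A) (Q : Setoid V) :
    stateSum o u w C (fun R => k * F R) Q = k * stateSum o u w C F Q := by
  rw [stateSum, stateSum, Finset.mul_sum]
  exact Finset.sum_congr rfl fun O _ => by ring

/-- Invariance under the first Reidemeister move: the factor `-T ^ μ` of the new chord cancels the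
factor `δ + T ^ μ = -T ^ (-μ)` from the local relation. -/
theorem jones_kink {D D' : ChordDiagram ℤˣ} {u v : List ℕ} {c : ℕ} (hD : D.word = u ++ v)
    (hD' : D'.word = u ++ [c, c] ++ v) (hm : ∀ x ∈ D.word, D'.mark x = D.mark x) :
    D'.jones = D.jones := by
  have hperm : List.Perm D'.word ([c, c] ++ D.word) := by
    rw [hD, hD']
    exact (List.perm_append_comm.append_right v).trans (by simp)
  have hc : c ∉ D.chords := not_mem_chords_of_perm hperm (by simp)
  have hC : D'.chords = insert c D.chords := by rw [chords_of_perm hperm]; ext; simp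
  have hm' : ∀ x ∈ D.chords, D'.mark x = D.mark x := fun x hx => hm x (List.mem_toFinset.1 hx)
  have hu : u.length ≤ u.length + v.length := Nat.le_add_right _ _
  rw [jones_eq_bracket D (N := u.length + v.length) hD (by simp),
    jones_eq_bracket D' (N := u.length + v.length + 2) hD' (by simp; omega), hC,
    Finset.prod_insert hc, bracket, bracket, stateSum_insert _ _ _ hc,
    ← glue_map_baseLoop hu, stateSum_insert_pair u v hu c c hc hc, stateSum_sup]
  set α : Fin (u.length + v.length + 2 + 1) := ⟨u.length, by omega⟩ with hα
  set m : Fin (u.length + v.length + 2 + 1) := ⟨u.length + 1, by omega⟩ with hmdef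
  set β : Fin (u.length + v.length + 2 + 1) := ⟨u.length + 2, by omega⟩ with hβ
  have hcount : D'.word.count c = 2 := D'.double c (hperm.mem_iff.2 (by simp))
  rw [hD'] at hcount
  have hpos := getElem?_of_append_pair (a := c) (b := c) (w := u ++ [c, c] ++ v) (u := u) (v := v) (by simp) rfl
  have hiff := getElem?_iff_of_count hcount (by omega) hpos.1 hpos.2
  rw [orient_eq_glue (x := α) (x' := m) (y := m) (y' := β) (by omega) hiff rfl rfl rfl rfl,
    disorient_eq_glue (x := α) (x' := m) (y := m) (y' := β) (by omega) hiff rfl rfl rfl rfl]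
  have hne : ∀ x ∈ D.chords, (u ++ [c, c] ++ v)[u.length]? ≠ some x ∧
      (u ++ [c, c] ++ v)[u.length + 1]? ≠ some x := fun x hx => by
    have : x ≠ c := fun h => hc (h ▸ hx)
    exact getElem?_ne_some_of_append (v := v) (by simp) this this
  have key : stateSum (orient (u.length + v.length + 2) (u ++ [c, c] ++ v))
      (disorient (u.length + v.length + 2) (u ++ [c, c] ++ v)) (fun c => T (D'.mark c : ℤ))
      D.chords (resolve (glue [(α, β), (m, m)]) (glue [(α, m), (m, β)]) (T (D'.mark c : ℤ))
        (loops circleValue)) (glue (baseLoop (u.length + v.length + 2))) =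
      (circleValue + T (D'.mark c : ℤ)) *
      stateSum (orient (u.length + v.length + 2) (u ++ [c, c] ++ v))
      (disorient (u.length + v.length + 2) (u ++ [c, c] ++ v)) (fun c => T (D.mark c : ℤ))
      D.chords (fun R => loops circleValue (R ⊔ glue [(α, m), (m, β)]))
      (glue (baseLoop (u.length + v.length + 2))) := by
    rw [← stateSum_const_mul]
    refine stateSum_congr (apart m) (fun _ _ => rfl) (fun _ _ => rfl)
      (fun x hx => by rw [hm' x hx])
      (baseLoop_le_apart (by simp [hmdef]) (by simp [hmdef]))
      (fun x hx => orient_le_apart rfl (hne x hx).1 (hne x hx).2)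
      (fun x hx => disorient_le_apart rfl (hne x hx).1 (hne x hx).2) fun R hR => ?_
    exact resolve_kink _ _ hR (by simp [hα, hmdef]) (by simp [hβ, hmdef])
  rw [key, Finset.prod_congr rfl fun x hx => by rw [hm' x hx], ← mul_assoc]
  congr 1
  have ht : (T 1 : ℤ[T;T⁻¹]) * T (-1) = 1 := by rw [← T_add]; simp
  rcases Int.units_eq_one_or (D'.mark c) with h | h <;>
    simp only [h, Units.val_one, Units.val_neg, circleValue] <;>
    linear_combination (∏ x ∈ D.chords, -(T (D.mark x : ℤ) : ℤ[T;T⁻¹])) * ht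

/-- Invariance under the second Reidemeister move; `l` is the order of the two chords on the second strand. -/
theorem jones_bigon {D D' : ChordDiagram ℤˣ} {u v w l : List ℕ} {c d : ℕ} (hcd : c ≠ d)
    (hl : l = [c, d] ∨ l = [d, c]) (hD : D.word = u ++ v ++ w)
    (hD' : D'.word = u ++ [c, d] ++ v ++ l ++ w) (hm : ∀ x ∈ D.word, D'.mark x = D.mark x)
    (hs : D'.mark d = -D'.mark c) : D'.jones = D.jones := by
  have hlp : List.Perm l [c, d] := by
    rcases hl with rfl | rfl
    · exact .refl _
    · exact .swap _ _ _
  have hperm : List.Perm D'.word ([c, d, c, d] ++ D.word) := by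
    rw [hD, hD', List.perm_iff_count]
    intro x
    have := hlp.count_eq x
    simp only [List.count_append, List.count_cons, List.count_nil] at this ⊢
    omega
  have hc : c ∉ D.chords := not_mem_chords_of_perm hperm (by simp)
  have hd : d ∉ D.chords := not_mem_chords_of_perm hperm (by
    simp only [List.count_cons, List.count_nil, BEq.rfl, if_true]
    omega)
  have hC : D'.chords = insert c (insert d D.chords) := by
    rw [chords_of_perm hperm]; ext; simp
  have hc' : c ∉ insert d D.chords := by simp [hcd, hc]
  have hm' : ∀ x ∈ D.chords, D'.mark x = D.mark x := fun x hx => hm x (List.mem_toFinset.1 hx)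
  obtain ⟨a, b, rfl, hab⟩ : ∃ a b, l = [a, b] ∧ (a = c ∧ b = d ∨ a = d ∧ b = c) := by
    rcases hl with rfl | rfl
    · exact ⟨c, d, rfl, .inl ⟨rfl, rfl⟩⟩
    · exact ⟨d, c, rfl, .inr ⟨rfl, rfl⟩⟩
  have ha : a ∉ D.chords := by rcases hab with ⟨rfl, rfl⟩ | ⟨rfl, rfl⟩ <;> assumption
  have hb : b ∉ D.chords := by rcases hab with ⟨rfl, rfl⟩ | ⟨rfl, rfl⟩ <;> assumption
  set i := u.length with hi
  set j := u.length + 2 + v.length with hj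
  set N := u.length + v.length + w.length with hN
  have hD2 : D.word = u ++ (v ++ w) := by rw [hD, List.append_assoc]
  have hD3 : u ++ [c, d] ++ (v ++ w) = (u ++ [c, d] ++ v) ++ w := by simp
  have hu : u.length ≤ N := by omega
  have hv : (u ++ [c, d] ++ v).length ≤ N + 2 := by simp; omega
  have hjlen : (u ++ [c, d] ++ v).length = j := by simp; omega
  have hL : baseLoop (N + 2) ++ consecutive hu = (baseLoop (N + 2 + 2) ++
      consecutive (hu.trans (Nat.le_add_right N 2))).map
        (Prod.map (collapse hv) (collapse hv)) := by
    rw [List.map_append, glue_map_baseLoop]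
    congr 1
    simp only [consecutive, List.map_cons, List.map_nil, Prod.map_apply, List.cons.injEq,
      Prod.mk.injEq, and_true, Fin.ext_iff, collapse, hjlen]
    split_ifs <;> omega
  rw [jones_eq_bracket D (N := N) hD2 (by simp; omega),
    jones_eq_bracket D' (N := N + 2 + 2) hD' (by simp; omega), hC,
    Finset.prod_insert hc', Finset.prod_insert hd, bracket, bracket, stateSum_insert _ _ _ hc',
    stateSum_insert _ _ _ hd, ← glue_map_baseLoop hu, stateSum_insert_pair u _ hu c d hc hd,
    ← glue_append, hD3, hL, stateSum_insert_pair _ w hv a b ha hb, glue_append, sup_assoc,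
    ← glue_append, stateSum_sup]
  have hx : ∃ α m β γ n ε : Fin (N + 2 + 2 + 1), α.val = i ∧ m.val = i + 1 ∧ β.val = i + 2 ∧
      γ.val = j ∧ n.val = j + 1 ∧ ε.val = j + 2 := by
    refine ⟨⟨i, by omega⟩, ⟨i + 1, by omega⟩, ⟨i + 2, by omega⟩, ⟨j, by omega⟩,
      ⟨j + 1, by omega⟩, ⟨j + 2, by omega⟩, rfl, rfl, rfl, rfl, rfl, rfl⟩
  obtain ⟨α, m, β, γ, n, ε, hα, hm1, hβ, hγ, hn1, hε⟩ := hx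
  have hE : consecutive (hu.trans (Nat.le_add_right N 2)) ++ consecutive hv =
      [(α, m), (m, β), (γ, n), (n, ε)] := by
    simp only [consecutive, List.cons_append, List.nil_append, List.cons.injEq, Prod.mk.injEq, and_true,
      Fin.ext_iff, hjlen]
    omega
  rw [hE]
  have hposu := getElem?_of_append_pair (a := c) (b := d) (w := u ++ [c, d] ++ v ++ [a, b] ++ w) (u := u)
    (v := v ++ [a, b] ++ w) (i := i) (by simp) hi
  have hposv := getElem?_of_append_pair (a := a) (b := b) (w := u ++ [c, d] ++ v ++ [a, b] ++ w) (u := u ++ [c, d] ++ v)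
    (v := w) (i := j) (by simp) hjlen.symm
  have hcountc : D'.word.count c = 2 := D'.double c (hperm.mem_iff.2 (by simp))
  have hcountd : D'.word.count d = 2 := D'.double d (hperm.mem_iff.2 (by simp))
  rw [hD'] at hcountc hcountd
  have hneu : ∀ x ∈ D.chords, (u ++ [c, d] ++ v ++ [a, b] ++ w)[i]? ≠ some x ∧
      (u ++ [c, d] ++ v ++ [a, b] ++ w)[i + 1]? ≠ some x := fun x hx =>
    getElem?_ne_some_of_append (a := c) (b := d) (v := v ++ [a, b] ++ w) (by simp) (fun h => hc (h ▸ hx))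
      (fun h => hd (h ▸ hx))
  have hnev : ∀ x ∈ D.chords, (u ++ [c, d] ++ v ++ [a, b] ++ w)[j]? ≠ some x ∧
      (u ++ [c, d] ++ v ++ [a, b] ++ w)[j + 1]? ≠ some x := fun x hx => by
    rw [← hjlen]
    exact getElem?_ne_some_of_append (a := a) (b := b) (v := w) (by simp) (fun h => ha (h ▸ hx)) (fun h => hb (h ▸ hx))
  have ht : (T 1 : ℤ[T;T⁻¹]) * T (-1) = 1 := by rw [← T_add]; simp
  have hw1 : (T (D'.mark c : ℤ) : ℤ[T;T⁻¹]) * T (D'.mark d : ℤ) = 1 := by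
    rw [hs, ← T_add]; simp
  have hw2 : (T (D'.mark c : ℤ) : ℤ[T;T⁻¹]) + T (D'.mark d : ℤ) + circleValue = 0 := by
    rw [hs]
    rcases Int.units_eq_one_or (D'.mark c) with h | h <;>
      simp only [h, Units.val_one, Units.val_neg, circleValue, neg_neg] <;> ring
  -- opposite signs: the factors `-T ^ μ` of the two new chords cancel
  rw [Finset.prod_congr rfl fun x hx => by rw [hm' x hx], ← mul_assoc (-T _), neg_mul_neg, hw1,
    one_mul]
  congr 1
  refine stateSum_congr (apart m ⊓ apart n) (fun _ _ => rfl) (fun _ _ => rfl)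
    (fun x hx => by rw [hm' x hx])
    (le_inf (baseLoop_le_apart (by omega) (by omega)) (baseLoop_le_apart (by omega) (by omega)))
    (fun x hx => le_inf (orient_le_apart hm1 (hneu x hx).1 (hneu x hx).2)
      (orient_le_apart hn1 (hnev x hx).1 (hnev x hx).2))
    (fun x hx => le_inf (disorient_le_apart hm1 (hneu x hx).1 (hneu x hx).2)
      (disorient_le_apart hn1 (hnev x hx).1 (hnev x hx).2)) fun R hR => ?_
  have hRm := hR.trans inf_le_left
  have hRn := hR.trans inf_le_right
  rcases hab with ⟨rfl, rfl⟩ | ⟨rfl, rfl⟩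
  · have hiffc := getElem?_iff_of_count hcountc (by omega) hposu.1 hposv.1
    have hiffd := getElem?_iff_of_count hcountd (by omega) hposu.2 hposv.2
    rw [orient_eq_glue (by omega) hiffc hα hm1 hγ hn1,
      disorient_eq_glue (by omega) hiffc hα hm1 hγ hn1,
      orient_eq_glue (by omega) hiffd hm1 hβ hn1 hε,
      disorient_eq_glue (by omega) hiffd hm1 hβ hn1 hε]
    apply resolve_bigon_direct _ _ _ hw1 hw2 hRm hRn <;> rw [ne_eq, Fin.ext_iff] <;> omega
  · have hiffc := getElem?_iff_of_count hcountc (by omega) hposu.1 hposv.2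
    have hiffd := getElem?_iff_of_count hcountd (by omega) hposu.2 hposv.1
    rw [orient_eq_glue (by omega) hiffc hα hm1 hn1 hε,
      disorient_eq_glue (by omega) hiffc hα hm1 hn1 hε,
      orient_eq_glue (by omega) hiffd hm1 hβ hγ hn1,
      disorient_eq_glue (by omega) hiffd hm1 hβ hγ hn1]
    apply resolve_bigon_reverse _ _ _ hw1 hw2 hRm hRn <;> rw [ne_eq, Fin.ext_iff] <;> omega

end Moves

/-! ### The third Reidemeister move -/

section Triangle

/-- The letters `x`, `y` in this order if `e = 1`, and in the other order otherwise. -/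
def pair {X : Type} (e : ℤˣ) (x y : X) : List X := if e = 1 then [x, y] else [y, x]

theorem pair_perm {X : Type} (e : ℤˣ) (x y : X) : List.Perm (pair e x y) [x, y] := by
  unfold pair
  split_ifs
  exacts [.refl _, .swap _ _ _]

theorem length_pair {X : Type} (e : ℤˣ) (x y : X) : (pair e x y).length = 2 :=
  (pair_perm e x y).length_eq

theorem count_pair (e : ℤˣ) (x y z : ℕ) : (pair e x y).count z = [x, y].count z :=
  (pair_perm e x y).count_eq z

/-- Resolving a chord in terms of its two strands, each of them traversed along the orientation if
the unit `e` or `e'` is `1`, and against it otherwise. -/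
theorem resolve_eq_cross {A : Type} [CommRing A] {N : ℕ} {w : List ℕ} {c p q : ℕ}
    (h : w.count c = 2) (hp : w[p]? = some c) (hq : w[q]? = some c) (hpq : p ≠ q) (e e' : ℤˣ)
    {x₀ x₁ y₀ y₁ : Fin (N + 1)}
    (hx : e = 1 ∧ x₀.val = p ∧ x₁.val = p + 1 ∨ e = -1 ∧ x₀.val = p + 1 ∧ x₁.val = p)
    (hy : e' = 1 ∧ y₀.val = q ∧ y₁.val = q + 1 ∨ e' = -1 ∧ y₀.val = q + 1 ∧ y₁.val = q)
    (t : A) (F : Setoid (Fin (N + 1)) → A) :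
    resolve (orient N w c) (disorient N w c) t F =
      cross x₀ x₁ y₀ y₁ (if e * e' = 1 then 1 else t) (if e * e' = 1 then t else 1) F := by
  have hiff := getElem?_iff_of_count h hpq hp hq
  have same : ∀ a a' b b' : Fin (N + 1), glue [(a, b'), (b, a')] = glue [(a, b'), (a', b)] :=
    fun a a' b b' => glue_congr (by intro X f; simp [eq_comm])
  have swap : ∀ a a' b b' : Fin (N + 1), glue [(a, b), (a', b')] = glue [(a', b'), (a, b)] :=
    fun a a' b b' => glue_congr (by intro X f; simp [and_comm])
  funext R
  rcases hx with ⟨rfl, hx0, hx1⟩ | ⟨rfl, hx0, hx1⟩ <;>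
    rcases hy with ⟨rfl, hy0, hy1⟩ | ⟨rfl, hy0, hy1⟩
  · rw [orient_eq_glue hpq hiff hx0 hx1 hy0 hy1, disorient_eq_glue hpq hiff hx0 hx1 hy0 hy1, same]
    simp [resolve, cross]
  · rw [orient_eq_glue hpq hiff hx0 hx1 hy1 hy0, disorient_eq_glue hpq hiff hx0 hx1 hy1 hy0, same]
    simp [resolve, cross]
    ring
  · rw [orient_eq_glue hpq hiff hx1 hx0 hy0 hy1, disorient_eq_glue hpq hiff hx1 hx0 hy0 hy1, same,
      swap x₁ x₀ y₁ y₀, swap x₁ x₀ y₀ y₁]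
    simp [resolve, cross]
    ring
  · rw [orient_eq_glue hpq hiff hx1 hx0 hy1 hy0, disorient_eq_glue hpq hiff hx1 hx0 hy1 hy0, same,
      swap x₁ x₀ y₀ y₁, swap x₁ x₀ y₁ y₀]
    simp [resolve, cross]

/-- The coefficient identity behind the third Reidemeister move.  It fails in the two excluded
cases, in which the triangle does not come from three lines at different heights. -/
theorem triangle_coefficients {α β γ : ℤˣ} (h : ¬ (γ = α ∧ β = -α)) :
    (T (α : ℤ) + T (γ : ℤ) + T (α : ℤ) * T (γ : ℤ) * circleValue +
      T (α : ℤ) * T (β : ℤ) * T (γ : ℤ) : ℤ[T;T⁻¹]) = T (β : ℤ) := by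
  have ht : (T 1 : ℤ[T;T⁻¹]) * T (-1) = 1 := by rw [← T_add]; simp
  rcases Int.units_eq_one_or α with rfl | rfl <;> rcases Int.units_eq_one_or β with rfl | rfl <;>
    rcases Int.units_eq_one_or γ with rfl | rfl
  · simp only [Units.val_one, circleValue]
    linear_combination -T 1 * ht
  · simp only [Units.val_one, Units.val_neg, circleValue]
    linear_combination -T (-1) * ht
  · simp at h
  · simp only [Units.val_one, Units.val_neg, circleValue]
    linear_combination -T 1 * ht
  · simp only [Units.val_one, Units.val_neg, circleValue]
    linear_combination -T (-1) * ht
  · simp at h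
  · simp only [Units.val_one, Units.val_neg, circleValue]
    linear_combination -T 1 * ht
  · simp only [Units.val_one, Units.val_neg, circleValue]
    linear_combination -T (-1) * ht

theorem getElem?_pair_of_eq {w u v : List ℕ} {e : ℤˣ} {a b i : ℕ}
    (hw : w = u ++ (pair e a b ++ v)) (hi : i = u.length) :
    w[if e = 1 then i else i + 1]? = some a ∧ w[if e = 1 then i + 1 else i]? = some b := by
  unfold pair at hw
  split_ifs at hw ⊢
  · exact getElem?_of_append_pair hw hi
  · exact (getElem?_of_append_pair hw hi).symm

theorem getElem?_pair_ne {w u v : List ℕ} {e : ℤˣ} {a b c i : ℕ}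
    (hw : w = u ++ (pair e a b ++ v)) (hi : i = u.length) (ha : c ≠ a) (hb : c ≠ b) :
    w[i]? ≠ some c ∧ w[i + 1]? ≠ some c := by
  unfold pair at hw
  subst hi
  split_ifs at hw
  · exact getElem?_ne_some_of_append hw ha hb
  · exact getElem?_ne_some_of_append hw hb ha

/-- Invariance under the third Reidemeister move.  The chord `a` joins the first and second strands, `b` the first and
third, `c` the second and third; `e`, `e'`, `e''` are the orders on the strands.  The hypothesis `h`
excludes the triangles for which no choice of heights of the three strands fits the signs. -/
theorem jones_triangle {D D' : ChordDiagram ℤˣ} {u₀ u₁ u₂ u₃ : List ℕ} {a b c : ℕ}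
    {e e' e'' : ℤˣ}
    (hD : D.word = u₀ ++ pair e a b ++ u₁ ++ pair e' a c ++ u₂ ++ pair e'' b c ++ u₃)
    (hD' : D'.word = u₀ ++ pair (-e) a b ++ u₁ ++ pair (-e') a c ++ u₂ ++ pair (-e'') b c ++ u₃)
    (hm : ∀ x ∈ D.word, D'.mark x = D.mark x)
    (h : ¬ (D.mark c * (e' * e'') = D.mark a * (e * e') ∧
      D.mark b * (e * e'') = -(D.mark a * (e * e')))) :
    D'.jones = D.jones := by
  have hcount : ∀ x ∈ D.word, D.word.count x = 2 := D.double
  have hperm : List.Perm D'.word D.word := by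
    rw [hD, hD', List.perm_iff_count]
    intro x
    simp only [List.count_append, count_pair]
  have hmem : a ∈ D.word ∧ b ∈ D.word ∧ c ∈ D.word := by
    simp [hD, (pair_perm _ _ _).mem_iff]
  have ha2 := hcount a hmem.1
  have hb2 := hcount b hmem.2.1
  have hc2 := hcount c hmem.2.2
  have ha2' := hperm.count_eq a ▸ ha2
  have hb2' := hperm.count_eq b ▸ hb2
  have hc2' := hperm.count_eq c ▸ hc2
  have hne : a ≠ b ∧ a ≠ c ∧ b ≠ c := by
    rw [hD] at ha2 hb2
    simp only [List.count_append, count_pair, List.count_cons, List.count_nil, beq_iff_eq]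
      at ha2 hb2
    refine ⟨?_, ?_, ?_⟩ <;> rintro rfl <;> simp at ha2 hb2 <;> omega
  obtain ⟨hab, hac, hbc⟩ := hne
  set C := D.chords \ {a, b, c} with hCdef
  have hCab : D.chords = insert a (insert b (insert c C)) := by
    have h1 : a ∈ D.chords ∧ b ∈ D.chords ∧ c ∈ D.chords := by
      simpa [ChordDiagram.chords] using hmem
    ext x
    simp only [hCdef, Finset.mem_insert, Finset.mem_sdiff, Finset.mem_singleton]
    by_cases hxa : x = a
    · simp [hxa, h1]
    by_cases hxb : x = b
    · simp [hxb, h1]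
    by_cases hxc : x = c
    · simp [hxc, h1]
    simp [hxa, hxb, hxc]
  have hC' : D'.chords = D.chords := List.toFinset_eq_of_perm _ _ hperm
  have hcC : c ∉ C := by simp [hCdef]
  have hbC : b ∉ insert c C := by simp [hCdef, hbc]
  have haC : a ∉ insert b (insert c C) := by simp [hCdef, hab, hac]
  have hCne : ∀ x ∈ C, x ≠ a ∧ x ≠ b ∧ x ≠ c := by
    intro x hx
    simp only [hCdef, Finset.mem_insert, Finset.mem_sdiff, Finset.mem_singleton] at hx
    tauto
  have hm' : ∀ x ∈ D.chords, D'.mark x = D.mark x := fun x hx => hm x (List.mem_toFinset.1 hx)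
  set i := u₀.length with hi
  set j := i + 2 + u₁.length with hj
  set k := j + 2 + u₂.length with hk
  set N := k + 2 + u₃.length with hN
  have hNw : D.word.length = N := by
    rw [hD]
    simp only [List.length_append, length_pair]
    omega
  have hNw' : D'.word.length = N := by
    rw [hD']
    simp only [List.length_append, length_pair]
    omega
  rw [jones_eq_bracket D rfl hNw, jones_eq_bracket D' rfl hNw', hC',
    Finset.prod_congr rfl fun x hx => by rw [hm' x hx]]
  congr 1
  rw [bracket, bracket, hCab, stateSum_insert _ _ _ haC, stateSum_insert _ _ _ haC,
    stateSum_insert _ _ _ hbC, stateSum_insert _ _ _ hbC, stateSum_insert _ _ _ hcC,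
    stateSum_insert _ _ _ hcC]
  have hma : D'.mark a = D.mark a := hm a hmem.1
  have hmb : D'.mark b = D.mark b := hm b hmem.2.1
  have hmc : D'.mark c = D.mark c := hm c hmem.2.2
  -- the arcs of the three strands, traversed against the orientation if the unit is `-1`
  have harcs : ∀ (f : ℤˣ) (m : ℕ), m + 2 ≤ N → ∃ x₀ x₁ x₂ : Fin (N + 1), x₁.val = m + 1 ∧
      (f = 1 ∧ x₀.val = m ∧ x₂.val = m + 2 ∨ f = -1 ∧ x₀.val = m + 2 ∧ x₂.val = m) := by
    intro f m hmN
    rcases Int.units_eq_one_or f with rfl | rfl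
    · exact ⟨⟨m, by omega⟩, ⟨m + 1, by omega⟩, ⟨m + 2, by omega⟩, rfl, .inl ⟨rfl, rfl, rfl⟩⟩
    · exact ⟨⟨m + 2, by omega⟩, ⟨m + 1, by omega⟩, ⟨m, by omega⟩, rfl, .inr ⟨rfl, rfl, rfl⟩⟩
  obtain ⟨x₀, x₁, x₂, hx₁, hx⟩ := harcs e i (by omega)
  obtain ⟨y₀, y₁, y₂, hy₁, hy⟩ := harcs e' j (by omega)
  obtain ⟨z₀, z₁, z₂, hz₁, hz⟩ := harcs e'' k (by omega)
  have w0 : D.word = u₀ ++ (pair e a b ++ (u₁ ++ pair e' a c ++ u₂ ++ pair e'' b c ++ u₃)) := by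
    simp [hD]
  have w1 : D.word = (u₀ ++ pair e a b ++ u₁) ++ (pair e' a c ++ (u₂ ++ pair e'' b c ++ u₃)) := by
    simp [hD]
  have w2 : D.word = (u₀ ++ pair e a b ++ u₁ ++ pair e' a c ++ u₂) ++ (pair e'' b c ++ u₃) := by
    simp [hD]
  have w0' : D'.word = u₀ ++ (pair (-e) a b ++
      (u₁ ++ pair (-e') a c ++ u₂ ++ pair (-e'') b c ++ u₃)) := by simp [hD']
  have w1' : D'.word = (u₀ ++ pair (-e) a b ++ u₁) ++ (pair (-e') a c ++
      (u₂ ++ pair (-e'') b c ++ u₃)) := by simp [hD']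
  have w2' : D'.word = (u₀ ++ pair (-e) a b ++ u₁ ++ pair (-e') a c ++ u₂) ++
      (pair (-e'') b c ++ u₃) := by simp [hD']
  have lj : ∀ f : ℤˣ, j = (u₀ ++ pair f a b ++ u₁).length := fun f => by
    simp only [List.length_append, length_pair, hj, hi]
  have lk : ∀ f f' : ℤˣ, k = (u₀ ++ pair f a b ++ u₁ ++ pair f' a c ++ u₂).length :=
    fun f f' => by simp only [List.length_append, length_pair, hk, hj, hi]
  have g0 := getElem?_pair_of_eq w0 hi
  have g1 := getElem?_pair_of_eq w1 (lj _)
  have g2 := getElem?_pair_of_eq w2 (lk _ _)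
  have g0' := getElem?_pair_of_eq w0' hi
  have g1' := getElem?_pair_of_eq w1' (lj _)
  have g2' := getElem?_pair_of_eq w2' (lk _ _)
  have hneg : ∀ f : ℤˣ, -f = 1 ↔ f = -1 := fun f => neg_eq_iff_eq_neg
  have hunit := Int.units_eq_one_or
  have hone : (1 : ℤˣ) ≠ -1 := by decide
  rw [resolve_eq_cross (x₀ := x₀) (x₁ := x₁) (y₀ := y₀) (y₁ := y₁) ha2 g0.1 g1.1
      (by split_ifs <;> omega) e e' (by rcases hx with hx | hx <;> simp [hx, hx₁, hone.symm])
      (by rcases hy with hy | hy <;> simp [hy, hy₁, hone.symm]),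
    resolve_eq_cross (x₀ := x₁) (x₁ := x₂) (y₀ := z₀) (y₁ := z₁) hb2 g0.2 g2.1
      (by split_ifs <;> omega) e e'' (by rcases hx with hx | hx <;> simp [hx, hx₁, hone.symm])
      (by rcases hz with hz | hz <;> simp [hz, hz₁, hone.symm]),
    resolve_eq_cross (x₀ := y₁) (x₁ := y₂) (y₀ := z₁) (y₁ := z₂) hc2 g1.2 g2.2
      (by split_ifs <;> omega) e' e'' (by rcases hy with hy | hy <;> simp [hy, hy₁, hone.symm])
      (by rcases hz with hz | hz <;> simp [hz, hz₁, hone.symm]),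
    resolve_eq_cross (x₀ := x₁) (x₁ := x₂) (y₀ := y₁) (y₁ := y₂) ha2' g0'.1 g1'.1
      (by split_ifs <;> omega) e e' (by rcases hx with hx | hx <;> simp [hx, hx₁, hone.symm])
      (by rcases hy with hy | hy <;> simp [hy, hy₁, hone.symm]),
    resolve_eq_cross (x₀ := x₀) (x₁ := x₁) (y₀ := z₁) (y₁ := z₂) hb2' g0'.2 g2'.1
      (by split_ifs <;> omega) e e'' (by rcases hx with hx | hx <;> simp [hx, hx₁, hone.symm])
      (by rcases hz with hz | hz <;> simp [hz, hz₁, hone.symm]),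
    resolve_eq_cross (x₀ := y₀) (x₁ := y₁) (y₀ := z₀) (y₁ := z₁) hc2' g1'.2 g2'.2
      (by split_ifs <;> omega) e' e'' (by rcases hy with hy | hy <;> simp [hy, hy₁, hone.symm])
      (by rcases hz with hz | hz <;> simp [hz, hz₁, hone.symm]),
    hma, hmb, hmc]
  have hwords : ∀ x ∈ C, ∀ m : ℕ, D'.word[m]? = some x ↔ D.word[m]? = some x := by
    intro x hxC m
    obtain ⟨h1, h2, h3⟩ := hCne x hxC
    have hp : ∀ (f : ℤˣ) {p q : ℕ}, x ≠ p → x ≠ q →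
        (pair (-f) p q).map (fun z => decide (z = x)) = (pair f p q).map fun z => decide (z = x) := by
      intro f p q hxp hxq
      unfold pair
      split_ifs <;> simp [hxp.symm, hxq.symm]
    have hmap : D'.word.map (fun z => decide (z = x)) = D.word.map fun z => decide (z = x) := by
      rw [hD, hD']
      simp only [List.map_append, hp _ h1 h2, hp _ h1 h3, hp _ h2 h3]
    have key : ∀ w : List ℕ, w[m]? = some x ↔
        (w.map fun z => decide (z = x))[m]? = some true := by
      intro w
      rw [List.getElem?_map]
      simp
    rw [key, key, hmap]
  have n0 : ∀ x ∈ C, _ := fun x hxC =>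
    getElem?_pair_ne w0' hi (hCne x hxC).1 (hCne x hxC).2.1
  have n1 : ∀ x ∈ C, _ := fun x hxC =>
    getElem?_pair_ne w1' (lj _) (hCne x hxC).1 (hCne x hxC).2.2
  have n2 : ∀ x ∈ C, _ := fun x hxC =>
    getElem?_pair_ne w2' (lk _ _) (hCne x hxC).2.1 (hCne x hxC).2.2
  refine stateSum_congr (apart x₁ ⊓ apart y₁ ⊓ apart z₁)
    (fun x hxC => orient_congr (hwords x hxC)) (fun x hxC => disorient_congr (hwords x hxC))
    (fun x hxC => by rw [hm' x (Finset.sdiff_subset hxC)])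
    (le_inf (le_inf (baseLoop_le_apart (by omega) (by omega))
      (baseLoop_le_apart (by omega) (by omega))) (baseLoop_le_apart (by omega) (by omega)))
    (fun x hxC => le_inf (le_inf (orient_le_apart hx₁ (n0 x hxC).1 (n0 x hxC).2)
      (orient_le_apart hy₁ (n1 x hxC).1 (n1 x hxC).2))
      (orient_le_apart hz₁ (n2 x hxC).1 (n2 x hxC).2))
    (fun x hxC => le_inf (le_inf (disorient_le_apart hx₁ (n0 x hxC).1 (n0 x hxC).2)
      (disorient_le_apart hy₁ (n1 x hxC).1 (n1 x hxC).2))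
      (disorient_le_apart hz₁ (n2 x hxC).1 (n2 x hxC).2)) fun R hR => ?_
  have hRx := hR.trans (inf_le_left.trans inf_le_left)
  have hRy := hR.trans (inf_le_left.trans inf_le_right)
  have hRz := hR.trans inf_le_right
  refine (cross_triangle _ _ _ _ _ _ _ ?_ hRx hRy hRz ?_ ?_ ?_ ?_).symm
  · -- the weights `s`, `t` of the two smoothings of a crossing satisfy `t = s * T (μ * f)`
    have hratio : ∀ μ f : ℤˣ, (if f = 1 then (T (μ : ℤ) : ℤ[T;T⁻¹]) else 1) =
        (if f = 1 then 1 else T (μ : ℤ)) * T ((μ * f : ℤˣ) : ℤ) := by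
      intro μ f
      rcases Int.units_eq_one_or f with rfl | rfl
      · simp
      · rw [if_neg hone.symm, if_neg hone.symm, ← T_add]
        simp
    rw [hratio (D.mark a), hratio (D.mark b), hratio (D.mark c)]
    have := triangle_coefficients h
    linear_combination (if e * e' = 1 then 1 else T (D.mark a : ℤ)) *
      (if e * e'' = 1 then 1 else T (D.mark b : ℤ)) *
      (if e' * e'' = 1 then 1 else T (D.mark c : ℤ)) * this
  · rw [ne_eq, Fin.ext_iff]; omega
  · rw [ne_eq, Fin.ext_iff]; omega
  · rw [ne_eq, Fin.ext_iff]; omega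
  · simp only [List.forall_mem_cons, List.not_mem_nil, false_implies, implies_true, and_true,
      ne_eq, Fin.ext_iff]
    omega

end Triangle

/-! ### Relabelling -/

/-- Invariance under relabelling the chords. -/
theorem jones_relabel {D D' : ChordDiagram ℤˣ} (f : ℕ ≃ ℕ) (hw : D'.word = D.word.map f)
    (hm : ∀ x ∈ D.word, D'.mark (f x) = D.mark x) : D'.jones = D.jones := by
  have hC : D'.chords = D.chords.map f.toEmbedding := by
    ext x
    simp only [ChordDiagram.chords, hw, List.mem_toFinset, List.mem_map, Finset.mem_map,
      Equiv.coe_toEmbedding]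
  have hm' : ∀ x ∈ D.chords, D'.mark (f x) = D.mark x := fun x hx => hm x (List.mem_toFinset.1 hx)
  have hget : ∀ (c m : ℕ), (D.word.map f)[m]? = some (f c) ↔ D.word[m]? = some c := by
    intro c m
    rw [List.getElem?_map]
    simp
  have ho : ∀ c, orient D.word.length (D.word.map f) (f c) = orient D.word.length D.word c := by
    intro c
    simp only [orient, hget]
  have hu : ∀ c,
      disorient D.word.length (D.word.map f) (f c) = disorient D.word.length D.word c := by
    intro c
    simp only [disorient, hget]
  rw [jones_eq_bracket D rfl rfl, jones_eq_bracket D' hw (N := D.word.length) (by simp), hC,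
    Finset.prod_map]
  congr 1
  · exact Finset.prod_congr rfl fun c hc => by rw [Equiv.coe_toEmbedding, hm' c hc]
  · rw [bracket, bracket, stateSum, stateSum]
    refine (Finset.sum_nbij' (fun O => O.map f.toEmbedding) (fun O => O.map f.symm.toEmbedding)
      ?_ ?_ ?_ ?_ ?_).symm
    · intro O hO
      rw [Finset.mem_powerset] at hO ⊢
      exact Finset.map_subset_map.2 hO
    · intro O hO
      rw [Finset.mem_powerset] at hO ⊢
      have := Finset.map_subset_map (f := f.symm.toEmbedding).2 hO
      simpa [Finset.map_map] using this
    · intro O _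
      ext x
      simp
    · intro O _
      ext x
      simp
    · intro O hO
      rw [Finset.prod_map]
      congr 1
      · exact Finset.prod_congr rfl fun c hc => by
          rw [Equiv.coe_toEmbedding, hm' c (Finset.mem_powerset.1 hO hc)]
      · congr 1
        unfold stateRel
        rw [Finset.sup_map]
        congr 1
        refine Finset.sup_congr rfl fun c _ => ?_
        simp [ho, hu]

/-! ### Reidemeister moves and projections -/

section Projections

/-- The result of `i ∘ p`: the sign of a chord is kept if its arrow is first met at its tail, and
reversed otherwise. -/
theorem mark_i_p (G : GaussDiagram) (c : ℕ) [Decidable (G.FirstOver c)] :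
    (i (p G)).mark c = if G.FirstOver c then G.sign c else -G.sign c := by
  rcases Int.units_eq_one_or (G.sign c) with h | h <;> by_cases h' : G.FirstOver c <;>
    simp [i, p, h, h']

theorem idxOf_lt_idxOf_iff (l : List (ℕ × Bool)) (c : ℕ) :
    l.idxOf (c, true) < l.idxOf (c, false) ↔ (l.filter (·.1 = c)).head? = some (c, true) := by
  induction l with
  | nil => simp
  | cons x l ih =>
    obtain ⟨d, o⟩ := x
    by_cases h : d = c
    · subst h
      cases o <;> simp
    · simp [h, ih]

/-- Whether a chord is first met at its tail can be read off its two letters. -/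
theorem firstOver_iff (G : GaussDiagram) (c : ℕ) :
    G.FirstOver c ↔ (G.word.filter (·.1 = c)).head? = some (c, true) :=
  idxOf_lt_idxOf_iff G.word c

theorem mark_i_p_congr {G H : GaussDiagram} {c d : ℕ} (hs : H.sign d = G.sign c)
    (h : H.FirstOver d ↔ G.FirstOver c) : (i (p H)).mark d = (i (p G)).mark c := by
  classical
  rw [mark_i_p, mark_i_p, hs]
  simp only [h]

theorem firstOver_congr {G H : GaussDiagram} {c : ℕ}
    (h : H.word.filter (·.1 = c) = G.word.filter (·.1 = c)) :
    H.FirstOver c ↔ G.FirstOver c := by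
  rw [firstOver_iff, firstOver_iff, h]

/-- A chord one of whose letters comes before a cut of the word and the other one after it. -/
theorem firstOver_of_append {G : GaussDiagram} {l l' : List (ℕ × Bool)} {c : ℕ} {o : Bool}
    (h : G.word = l ++ l') (h1 : (c, o) ∈ l) (h2 : (c, !o) ∈ l') :
    G.FirstOver c ↔ o = true := by
  have hn := G.nodup
  rw [h, List.nodup_append'] at hn
  have h3 : (c, !o) ∉ l := fun h3 => hn.2.2 h3 h2
  have h4 := List.idxOf_lt_length_of_mem h1
  rw [GaussDiagram.FirstOver, h]
  cases o
  · simp only [Bool.not_false] at h2 h3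
    rw [List.idxOf_append_of_notMem h3, List.idxOf_append_of_mem h1]
    simp
    omega
  · simp only [Bool.not_true] at h2 h3
    rw [List.idxOf_append_of_notMem h3, List.idxOf_append_of_mem h1]
    simp
    omega

/-- The chords that a move creates are new. -/
theorem ne_of_perm {G H : GaussDiagram} {l : List (ℕ × Bool)} {c x : ℕ} {o : Bool}
    (h : List.Perm H.word (l ++ G.word)) (hc : (c, o) ∈ l) (hx : x ∈ G.word.map Prod.fst) :
    x ≠ c := by
  rintro rfl
  obtain ⟨⟨x, o'⟩, hx', rfl⟩ := List.mem_map.1 hx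
  have hn := (h.nodup_iff).1 H.nodup
  rw [List.nodup_append'] at hn
  refine hn.2.2 hc ?_
  have := G.paired x o' hx'
  cases o <;> cases o' <;> assumption

theorem signs_of_signsExtend {G H : GaussDiagram} (hs : GaussDiagram.SignsExtend G H) {x : ℕ}
    (hx : x ∈ G.word.map Prod.fst) : H.sign x = G.sign x := by
  obtain ⟨⟨x, o⟩, h, rfl⟩ := List.mem_map.1 hx
  exact hs x o h

end Projections

/-! ### Invariance of both polynomials -/

section Invariance

theorem jones_omega1 {G H : GaussDiagram} {u v : List (ℕ × Bool)} {c : ℕ} {o : Bool}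
    (hG : G.word = u ++ v) (hH : H.word = u ++ [(c, o), (c, !o)] ++ v)
    (hs : GaussDiagram.SignsExtend G H) :
    (pr H).jones = (pr G).jones ∧ (i (p H)).jones = (i (p G)).jones := by
  have hw : G.word.map Prod.fst = u.map Prod.fst ++ v.map Prod.fst := by simp [hG]
  have hw' : H.word.map Prod.fst = u.map Prod.fst ++ [c, c] ++ v.map Prod.fst := by simp [hH]
  have hperm : List.Perm H.word ([(c, o), (c, !o)] ++ G.word) := by
    rw [hG, hH, ← List.append_assoc]
    exact List.perm_append_comm.append_right v
  refine ⟨jones_kink hw hw' fun x hx => signs_of_signsExtend hs hx,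
    jones_kink hw hw' fun x hx => mark_i_p_congr (signs_of_signsExtend hs hx)
      (firstOver_congr ?_)⟩
  have hxc : x ≠ c := ne_of_perm hperm (o := o) (by simp) hx
  simp [hG, hH, hxc.symm]

theorem jones_omega2 {G H : GaussDiagram} {u v w l : List (ℕ × Bool)} {c d : ℕ} {o : Bool}
    (hl : l = [(c, !o), (d, !o)] ∨ l = [(d, !o), (c, !o)]) (hG : G.word = u ++ v ++ w)
    (hH : H.word = u ++ [(c, o), (d, o)] ++ v ++ l ++ w)
    (hs : GaussDiagram.SignsExtend G H) (hcd : H.sign d = -H.sign c) :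
    (pr H).jones = (pr G).jones ∧ (i (p H)).jones = (i (p G)).jones := by
  classical
  have hw : G.word.map Prod.fst = u.map Prod.fst ++ v.map Prod.fst ++ w.map Prod.fst := by
    simp [hG]
  have hw' : H.word.map Prod.fst = u.map Prod.fst ++ [c, d] ++ v.map Prod.fst ++ l.map Prod.fst ++
      w.map Prod.fst := by simp [hH]
  have hl' : l.map Prod.fst = [c, d] ∨ l.map Prod.fst = [d, c] := by
    rcases hl with rfl | rfl <;> simp
  have hlc : (c, !o) ∈ l ∧ (d, !o) ∈ l := by rcases hl with rfl | rfl <;> simp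
  have hperm : List.Perm H.word ([(c, o), (d, o)] ++ l ++ G.word) := by
    rw [hG, hH, List.perm_iff_count]
    intro x
    simp only [List.count_append]
    omega
  have hne : c ≠ d := by
    rintro rfl
    have := H.nodup
    rw [hH] at this
    simp [List.nodup_append'] at this
  refine ⟨jones_bigon hne hl' hw hw' (fun x hx => signs_of_signsExtend hs hx) hcd,
    jones_bigon hne hl' hw hw' (fun x hx => mark_i_p_congr (signs_of_signsExtend hs hx)
      (firstOver_congr ?_)) ?_⟩
  · have hxc : x ≠ c := ne_of_perm hperm (o := o) (by simp) hx
    have hxd : x ≠ d := ne_of_perm hperm (o := o) (by simp) hx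
    rcases hl with rfl | rfl <;> simp [hG, hH, hxc.symm, hxd.symm]
  · have hH' : H.word = (u ++ [(c, o), (d, o)] ++ v) ++ (l ++ w) := by simp [hH]
    have h1 := firstOver_of_append (c := c) (o := o) hH' (by simp) (by simp [hlc])
    have h2 := firstOver_of_append (c := d) (o := o) hH' (by simp) (by simp [hlc])
    rw [mark_i_p, mark_i_p, hcd]
    simp only [h1, h2]
    split_ifs <;> rfl

theorem perm_fin_three (π : Equiv.Perm (Fin 3)) :
    (π 0 = 0 ∧ π 1 = 1 ∧ π 2 = 2 ∧ π.symm 0 = 0 ∧ π.symm 1 = 1 ∧ π.symm 2 = 2) ∨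
    (π 0 = 0 ∧ π 1 = 2 ∧ π 2 = 1 ∧ π.symm 0 = 0 ∧ π.symm 1 = 2 ∧ π.symm 2 = 1) ∨
    (π 0 = 1 ∧ π 1 = 0 ∧ π 2 = 2 ∧ π.symm 0 = 1 ∧ π.symm 1 = 0 ∧ π.symm 2 = 2) ∨
    (π 0 = 1 ∧ π 1 = 2 ∧ π 2 = 0 ∧ π.symm 0 = 2 ∧ π.symm 1 = 0 ∧ π.symm 2 = 1) ∨
    (π 0 = 2 ∧ π 1 = 0 ∧ π 2 = 1 ∧ π.symm 0 = 1 ∧ π.symm 1 = 2 ∧ π.symm 2 = 0) ∨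
    (π 0 = 2 ∧ π 1 = 1 ∧ π 2 = 0 ∧ π.symm 0 = 2 ∧ π.symm 1 = 1 ∧ π.symm 2 = 0) := by
  revert π
  decide

theorem pair_neg_swap {X : Type} (e : ℤˣ) (x y : X) : pair (-e) y x = pair e x y := by
  rcases Int.units_eq_one_or e with rfl | rfl <;> simp [pair]

theorem map_fst_ordered (e : ℤˣ) (x y : ℕ × Bool) :
    (GaussDiagram.ordered e x y).map Prod.fst = pair e x.1 y.1 := by
  unfold GaussDiagram.ordered pair
  split_ifs <;> rfl

/-- The third Reidemeister move for a chord diagram whose word is that of a Gauss diagram, and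
whose marks at the three chords are the signs up to a unit `η` that is either trivial or compares
the order of the two strands of a chord on the line with their heights: the latter is what the
projection `i ∘ p` does. -/
theorem jones_of_branches {D D' : ChordDiagram ℤˣ} {s : ℕ → ℤˣ} {e : ℤˣ} {a b c : ℕ}
    {u₀ u₁ u₂ u₃ : List (ℕ × Bool)} (π : Equiv.Perm (Fin 3))
    (hD : D.word = (u₀ ++ GaussDiagram.branches s a b c e (π 0) ++ u₁ ++
      GaussDiagram.branches s a b c e (π 1) ++ u₂ ++
      GaussDiagram.branches s a b c e (π 2) ++ u₃).map Prod.fst)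
    (hD' : D'.word = (u₀ ++ GaussDiagram.branches s a b c (-e) (π 0) ++ u₁ ++
      GaussDiagram.branches s a b c (-e) (π 1) ++ u₂ ++
      GaussDiagram.branches s a b c (-e) (π 2) ++ u₃).map Prod.fst)
    (hm : ∀ x ∈ D.word, D'.mark x = D.mark x) (η : Fin 3 → Fin 3 → ℤˣ)
    (hη : (∀ x y, η x y = 1) ∨ ∀ x y, η x y = if π.symm x < π.symm y then 1 else -1)
    (ha : D.mark a = η 0 1 * s a) (hb : D.mark b = η 0 2 * s b) (hc : D.mark c = η 1 2 * s c) :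
    D'.jones = D.jones := by
  have b0 : ∀ f, (GaussDiagram.branches s a b c f 0).map Prod.fst = pair f a b :=
    fun f => map_fst_ordered _ _ _
  have b1 : ∀ f, (GaussDiagram.branches s a b c f 1).map Prod.fst = pair (f * s b * s c) a c :=
    fun f => map_fst_ordered _ _ _
  have b2 : ∀ f, (GaussDiagram.branches s a b c f 2).map Prod.fst = pair (f * s a * s c) b c :=
    fun f => map_fst_ordered _ _ _
  simp only [List.map_append] at hD hD'
  -- in each of the six orders of the strands, name the chords by the order of their strands
  rcases perm_fin_three π with h | h | h | h | h | h <;>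
    obtain ⟨p0, p1, p2, q0, q1, q2⟩ := h <;>
    rw [p0, p1, p2, b0, b1, b2] at hD hD' <;>
    rw [neg_mul, neg_mul, neg_mul, neg_mul] at hD'
  on_goal 1 =>
    refine jones_triangle (a := a) (b := b) (c := c)
      (e := e) (e' := e * s b * s c) (e'' := e * s a * s c)
      (by rw [hD])
      (by rw [hD']) hm ?_
  on_goal 2 =>
    refine jones_triangle (a := b) (b := a) (c := c)
      (e := -e) (e' := e * s a * s c) (e'' := e * s b * s c)
      (by rw [hD, pair_neg_swap e a b])
      (by rw [hD', pair_neg_swap (-e) a b]) hm ?_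
  on_goal 3 =>
    refine jones_triangle (a := a) (b := c) (c := b)
      (e := e * s b * s c) (e' := e) (e'' := -(e * s a * s c))
      (by rw [hD, pair_neg_swap (e * s a * s c) b c])
      (by rw [hD', pair_neg_swap (-(e * s a * s c)) b c]) hm ?_
  on_goal 4 =>
    refine jones_triangle (a := c) (b := a) (c := b)
      (e := -(e * s b * s c)) (e' := -(e * s a * s c)) (e'' := e)
      (by rw [hD, pair_neg_swap (e * s b * s c) a c, pair_neg_swap (e * s a * s c) b c])
      (by rw [hD', pair_neg_swap (-(e * s b * s c)) a c,
        pair_neg_swap (-(e * s a * s c)) b c]) hm ?_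
  on_goal 5 =>
    refine jones_triangle (a := b) (b := c) (c := a)
      (e := e * s a * s c) (e' := -e) (e'' := -(e * s b * s c))
      (by rw [hD, pair_neg_swap e a b, pair_neg_swap (e * s b * s c) a c])
      (by rw [hD', pair_neg_swap (-e) a b, pair_neg_swap (-(e * s b * s c)) a c]) hm ?_
  on_goal 6 =>
    refine jones_triangle (a := c) (b := b) (c := a)
      (e := -(e * s a * s c)) (e' := -(e * s b * s c)) (e'' := -e)
      (by rw [hD, pair_neg_swap (e * s a * s c) b c, pair_neg_swap (e * s b * s c) a c,
        pair_neg_swap e a b])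
      (by rw [hD', pair_neg_swap (-(e * s a * s c)) b c, pair_neg_swap (-(e * s b * s c)) a c,
        pair_neg_swap (-e) a b]) hm ?_
  all_goals
    rcases hη with hη | hη <;> simp only [ha, hb, hc, hη, q0, q1, q2] <;>
      generalize s a = x <;> generalize s b = y <;> generalize s c = z <;> clear hD hD' <;>
      revert x y z e <;> decide

theorem mem_ordered (e : ℤˣ) (x y : ℕ × Bool) :
    x ∈ GaussDiagram.ordered e x y ∧ y ∈ GaussDiagram.ordered e x y := by
  unfold GaussDiagram.ordered
  split_ifs <;> simp

/-- In a third Reidemeister move, a chord whose tail is on the branch `s` and whose head is on the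
branch `t` is first met at its tail if and only if the branch `s` comes first on the line. -/
theorem firstOver_of_branches {G : GaussDiagram} {B : Fin 3 → List (ℕ × Bool)}
    {u₀ u₁ u₂ u₃ : List (ℕ × Bool)} (π : Equiv.Perm (Fin 3))
    (hG : G.word = u₀ ++ B (π 0) ++ u₁ ++ B (π 1) ++ u₂ ++ B (π 2) ++ u₃) {x : ℕ} {s t : Fin 3}
    (hst : s ≠ t) (hs : (x, true) ∈ B s) (ht : (x, false) ∈ B t) :
    G.FirstOver x ↔ π.symm s < π.symm t := by
  have key : ∀ (k l : Fin 3) (o : Bool), k < l → (x, o) ∈ B (π k) → (x, !o) ∈ B (π l) →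
      (G.FirstOver x ↔ o = true) := by
    intro k l o hkl hk hl
    by_cases hk0 : k = 0
    · subst hk0
      refine firstOver_of_append (l := u₀ ++ B (π 0)) (l' := u₁ ++ B (π 1) ++ u₂ ++ B (π 2) ++ u₃)
        (by simp [hG]) (by simp [hk]) ?_
      have : l = 1 ∨ l = 2 := by omega
      rcases this with rfl | rfl <;> simp [hl]
    · have hk1 : k = 1 := by omega
      have hl2 : l = 2 := by omega
      subst hk1 hl2
      exact firstOver_of_append (l := u₀ ++ B (π 0) ++ u₁ ++ B (π 1)) (l' := u₂ ++ B (π 2) ++ u₃)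
        (by simp [hG]) (by simp [hk]) (by simp [hl])
  rcases lt_trichotomy (π.symm s) (π.symm t) with h | h | h
  · rw [key _ _ true h (by simpa using hs) (by simpa using ht)]
    simp [h]
  · exact absurd (π.symm.injective h) hst
  · rw [key _ _ false h (by simpa using ht) (by simpa using hs)]
    simp [h.le]

theorem jones_omega3 {G H : GaussDiagram} {u₀ u₁ u₂ u₃ : List (ℕ × Bool)} {a b c : ℕ} {e : ℤˣ}
    {π : Equiv.Perm (Fin 3)}
    (hG : G.word = u₀ ++ GaussDiagram.branches G.sign a b c e (π 0) ++ u₁ ++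
      GaussDiagram.branches G.sign a b c e (π 1) ++ u₂ ++
      GaussDiagram.branches G.sign a b c e (π 2) ++ u₃)
    (hH : H.word = u₀ ++ GaussDiagram.branches G.sign a b c (-e) (π 0) ++ u₁ ++
      GaussDiagram.branches G.sign a b c (-e) (π 1) ++ u₂ ++
      GaussDiagram.branches G.sign a b c (-e) (π 2) ++ u₃)
    (hs : GaussDiagram.SignsExtend G H) :
    (pr H).jones = (pr G).jones ∧ (i (p H)).jones = (i (p G)).jones := by
  classical
  have hw := congrArg (List.map Prod.fst) hG
  have hw' := congrArg (List.map Prod.fst) hH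
  have hat : ∀ f, (a, true) ∈ GaussDiagram.branches G.sign a b c f 0 := fun f =>
    (mem_ordered _ _ _).1
  have hbt : ∀ f, (b, true) ∈ GaussDiagram.branches G.sign a b c f 0 := fun f =>
    (mem_ordered _ _ _).2
  have haf : ∀ f, (a, false) ∈ GaussDiagram.branches G.sign a b c f 1 := fun f =>
    (mem_ordered _ _ _).1
  have hct : ∀ f, (c, true) ∈ GaussDiagram.branches G.sign a b c f 1 := fun f =>
    (mem_ordered _ _ _).2
  have hbf : ∀ f, (b, false) ∈ GaussDiagram.branches G.sign a b c f 2 := fun f =>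
    (mem_ordered _ _ _).1
  have hcf : ∀ f, (c, false) ∈ GaussDiagram.branches G.sign a b c f 2 := fun f =>
    (mem_ordered _ _ _).2
  have hGa := firstOver_of_branches π hG (by decide) (hat e) (haf e)
  have hGb := firstOver_of_branches π hG (by decide) (hbt e) (hbf e)
  have hGc := firstOver_of_branches π hG (by decide) (hct e) (hcf e)
  have hHa := firstOver_of_branches π hH (by decide) (hat (-e)) (haf (-e))
  have hHb := firstOver_of_branches π hH (by decide) (hbt (-e)) (hbf (-e))
  have hHc := firstOver_of_branches π hH (by decide) (hct (-e)) (hcf (-e))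
  refine ⟨jones_of_branches π hw hw' (fun x hx => signs_of_signsExtend hs hx) (fun _ _ => 1)
    (.inl fun _ _ => rfl) (one_mul _).symm (one_mul _).symm (one_mul _).symm,
    jones_of_branches π hw hw' (fun x hx => mark_i_p_congr (signs_of_signsExtend hs hx) ?_)
      (fun x y => if π.symm x < π.symm y then 1 else -1) (.inr fun _ _ => rfl) ?_ ?_ ?_⟩
  · by_cases hxa : x = a
    · rw [hxa, hGa, hHa]
    by_cases hxb : x = b
    · rw [hxb, hGb, hHb]
    by_cases hxc : x = c
    · rw [hxc, hGc, hHc]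
    have hord : ∀ f (y z : ℕ × Bool), x ≠ y.1 → x ≠ z.1 →
        (GaussDiagram.ordered f y z).filter (·.1 = x) = [] := by
      intro f y z hy hz
      unfold GaussDiagram.ordered
      split_ifs <;> simp [hy.symm, hz.symm]
    have hbr : ∀ f k, (GaussDiagram.branches G.sign a b c f k).filter (·.1 = x) = [] := by
      intro f k
      fin_cases k
      · exact hord _ _ _ hxa hxb
      · exact hord _ _ _ hxa hxc
      · exact hord _ _ _ hxb hxc
    apply firstOver_congr
    rw [hG, hH]
    simp only [List.filter_append, hbr]
  · rw [mark_i_p]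
    simp only [hGa]
    split_ifs <;> simp
  · rw [mark_i_p]
    simp only [hGb]
    split_ifs <;> simp
  · rw [mark_i_p]
    simp only [hGc]
    split_ifs <;> simp

/-- Both polynomials are invariant under isomorphisms and Reidemeister moves. -/
theorem jones_move {G H : GaussDiagram} (h : GaussDiagram.Move G H) :
    (pr G).jones = (pr H).jones ∧ (i (p G)).jones = (i (p H)).jones := by
  suffices h : (pr H).jones = (pr G).jones ∧ (i (p H)).jones = (i (p G)).jones from
    ⟨h.1.symm, h.2.symm⟩
  cases h with
  | relabel f hw hs =>
    have hw' : H.word.map Prod.fst = (G.word.map Prod.fst).map f := by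
      rw [hw, List.map_map, List.map_map]
      rfl
    have hs' : ∀ x ∈ G.word.map Prod.fst, H.sign (f x) = G.sign x := by
      intro x hx
      obtain ⟨⟨x, o⟩, h, rfl⟩ := List.mem_map.1 hx
      exact hs x o h
    refine ⟨jones_relabel f hw' hs', jones_relabel f hw' fun x hx =>
      mark_i_p_congr (hs' x hx) ?_⟩
    rw [firstOver_iff, firstOver_iff, hw, List.filter_map, List.head?_map]
    have : ((fun y : ℕ × Bool => decide (y.1 = f x)) ∘ fun y : ℕ × Bool => (f y.1, y.2)) =
        fun y : ℕ × Bool => decide (y.1 = x) := by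
      funext y
      simp
    rw [this]
    simp
  | omega1 u v c o hG hH hs => exact jones_omega1 hG hH hs
  | omega2_direct u v w c d o hG hH hs hcd => exact jones_omega2 (.inl rfl) hG hH hs hcd
  | omega2_reverse u v w c d o hG hH hs hcd => exact jones_omega2 (.inr rfl) hG hH hs hcd
  | omega3 u₀ u₁ u₂ u₃ a b c e π hG hH hs => exact jones_omega3 hG hH hs

end Invariance

/-! ### The example -/

section Example

/-- Merging the class of `e.1` into the class of `e.2` in a labelling of points by classes. -/
def merge {V : Type} [DecidableEq V] (f : V → V) (e : V × V) : V → V :=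
  fun v => if f v = f e.1 then f e.2 else f v

theorem ker_merge {V : Type} [DecidableEq V] (f : V → V) (e : V × V) :
    Setoid.ker (merge f e) = Setoid.ker f ⊔ glue [e] := by
  apply le_antisymm
  · set S := Setoid.ker f ⊔ glue [e] with hS
    have h1 : ∀ {x y}, f x = f y → S x y := fun h => (le_sup_left : Setoid.ker f ≤ S) h
    have h2 : S e.1 e.2 :=
      (le_sup_right : glue [e] ≤ S) (Relation.EqvGen.rel _ _ (by simp))
    have h3 : ∀ {x}, f x = f e.1 → S x e.2 := fun h => S.trans' (h1 h) h2
    intro x y h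
    rw [Setoid.ker_def, merge, merge] at h
    split_ifs at h with hx hy hy
    · exact S.trans' (h3 hx) (S.symm' (h3 hy))
    · exact S.trans' (h3 hx) (h1 h)
    · exact S.trans' (h1 h) (S.symm' (h3 hy))
    · exact h1 h
  · refine sup_le (fun x y h => ?_) (glue_le_iff.2 ?_)
    · rw [Setoid.ker_def] at h ⊢
      rw [merge, merge, h]
    · intro e' he'
      rw [List.mem_singleton.1 he', Setoid.ker_def]
      simp only [merge, if_true]
      split_ifs <;> rfl

theorem ker_foldl_merge {V : Type} [DecidableEq V] (L : List (V × V)) (f : V → V) :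
    Setoid.ker (L.foldl merge f) = Setoid.ker f ⊔ glue L := by
  induction L generalizing f with
  | nil =>
    have : glue ([] : List (V × V)) ≤ Setoid.ker f := glue_le_iff.2 (by simp)
    rw [sup_eq_left.2 this]
    rfl
  | cons e L ih =>
    rw [List.foldl_cons, ih, ker_merge, sup_assoc, ← glue_append]
    rfl

/-- Counting the classes of a finitely generated relation by a union-find computation. -/
theorem classes_glue {V : Type} [DecidableEq V] [Fintype V] (L : List (V × V)) :
    classes (glue L) = (Finset.univ.image (L.foldl merge id)).card := by
  have h : Setoid.ker (L.foldl merge id) = glue L := by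
    rw [ker_foldl_merge]
    have : Setoid.ker (id : V → V) ≤ glue L := fun x y h =>
      (show x = y from h) ▸ Setoid.refl' _ _
    exact sup_eq_right.2 this
  rw [← h, classes, Nat.card_congr (Setoid.quotientKerEquivRange _), ← Set.image_univ,
    ← Finset.coe_univ, ← Finset.coe_image, Nat.card_coe_set_eq, Set.ncard_coe_finset]

theorem loops_glue {V A : Type} [CommRing A] [DecidableEq V] [Fintype V] (δ : A)
    (L : List (V × V)) (k : ℕ) (h : (Finset.univ.image (L.foldl merge id)).card = k + 1) :
    loops δ (glue L) = δ ^ k := by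
  rw [loops, classes_glue, h, Nat.add_sub_cancel]

/-- The two smoothings of a chord of the word of the example with ends at `k` and `l`. -/
theorem smoothings_example (c k l : ℕ) (hkl : k ≠ l)
    (h : [0, 1, 0, 2, 1, 2].count c = 2 ∧ [0, 1, 0, 2, 1, 2][k]? = some c ∧
      [0, 1, 0, 2, 1, 2][l]? = some c) (hk : k < 6) (hl : l < 6) :
    orient 6 [0, 1, 0, 2, 1, 2] c =
        glue [(⟨k, by omega⟩, ⟨l + 1, by omega⟩), (⟨l, by omega⟩, ⟨k + 1, by omega⟩)] ∧
      disorient 6 [0, 1, 0, 2, 1, 2] c =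
        glue [(⟨k, by omega⟩, ⟨l, by omega⟩), (⟨k + 1, by omega⟩, ⟨l + 1, by omega⟩)] := by
  have hiff := getElem?_iff_of_count h.1 hkl h.2.1 h.2.2
  exact ⟨orient_eq_glue hkl hiff rfl rfl rfl rfl, disorient_eq_glue hkl hiff rfl rfl rfl rfl⟩

theorem jones_diagram₁ : (pr diagram₁).jones = T (-4) - T (-2) - T (-1) + 1 + T 1 := by
  have h0 := smoothings_example 0 0 2 (by decide) (by decide) (by decide) (by decide)
  have h1 := smoothings_example 1 1 4 (by decide) (by decide) (by decide) (by decide)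
  have h2 := smoothings_example 2 3 5 (by decide) (by decide) (by decide) (by decide)
  have hC : (pr diagram₁).chords = insert 0 (insert 1 (insert 2 ∅)) := by
    rfl
  rw [jones_eq_bracket (pr diagram₁) (N := 6) (w := [0, 1, 0, 2, 1, 2]) rfl rfl, hC, bracket,
    stateSum_insert _ _ _ (by decide), stateSum_insert _ _ _ (by decide),
    stateSum_insert _ _ _ (by decide), h0.1, h0.2, h1.1, h1.2, h2.1, h2.2]
  simp only [stateSum, Finset.powerset_empty, Finset.sum_singleton, Finset.prod_empty, one_mul,
    stateRel, Finset.sup_empty, sup_bot_eq, resolve, ← glue_append]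
  rw [loops_glue _ _ 1, loops_glue _ _ 0, loops_glue _ _ 1, loops_glue _ _ 0, loops_glue _ _ 0,
    loops_glue _ _ 1, loops_glue _ _ 0, loops_glue _ _ 0]
  · have m0 : (pr diagram₁).mark 0 = -1 := by decide
    have m1 : (pr diagram₁).mark 1 = 1 := by decide
    have m2 : (pr diagram₁).mark 2 = -1 := by decide
    have ht : (T 1 : ℤ[T;T⁻¹]) * T (-1) = 1 := by rw [← T_add]; simp
    have h4 : (T (-4) : ℤ[T;T⁻¹]) = T (-1) ^ 4 := by rw [LaurentPolynomial.T_pow]; rfl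
    have h3 : (T (-2) : ℤ[T;T⁻¹]) = T (-1) ^ 2 := by rw [LaurentPolynomial.T_pow]; rfl
    rw [Finset.prod_insert (by decide), Finset.prod_insert (by decide),
      Finset.prod_insert (by decide), Finset.prod_empty, m0, m1, m2, h3, h4]
    simp only [Units.val_one, Units.val_neg, circleValue]
    generalize (T 1 : ℤ[T;T⁻¹]) = t at *
    generalize (T (-1) : ℤ[T;T⁻¹]) = s at *
    grind
  -- the numbers of circles of the eight states
  all_goals decide

theorem invert_jones_diagram₁_ne :
    LaurentPolynomial.invert (pr diagram₁).jones ≠ (pr diagram₁).jones := by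
  intro h
  have h1 := congrArg (fun f : ℤ[T;T⁻¹] => f.coeff (-4)) h
  rw [jones_diagram₁, ← T_zero] at h1
  simp [-T_zero] at h1

theorem jones_pr_diagram₂ : (pr diagram₂).jones = (pr diagram₁).jones :=
  jones_congr rfl fun _ _ => rfl

/-- All chords of the first diagram are first met at their tails, so `i ∘ p` keeps their signs. -/
theorem jones_i_p_diagram₁ : (i (p diagram₁)).jones = (pr diagram₁).jones := by
  classical
  refine jones_congr rfl fun c hc => ?_
  have h : ∀ c ∈ [0, 1, 0, 2, 1, 2], diagram₁.FirstOver c := by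
    unfold GaussDiagram.FirstOver
    decide
  rw [mark_i_p, if_pos (h c hc)]
  rfl

/-- All chords of the second diagram are first met at their heads, so `i ∘ p` reverses their
signs. -/
theorem jones_i_p_diagram₂ :
    (i (p diagram₂)).jones = LaurentPolynomial.invert (pr diagram₂).jones := by
  classical
  refine jones_neg rfl fun c hc => ?_
  have h : ∀ c ∈ [0, 1, 0, 2, 1, 2], ¬ diagram₂.FirstOver c := by
    unfold GaussDiagram.FirstOver
    decide
  rw [mark_i_p, if_neg (h c hc)]
  rfl

end Example

end LongVirtual

theorem theorem3p3 :
    ∃ V Vip : LongVirtual.LongVirtualKnot → ℤ[T;T⁻¹],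
      (∀ G : LongVirtual.GaussDiagram, V G.knot = (LongVirtual.pr G).jones) ∧
      (∀ G : LongVirtual.GaussDiagram,
        Vip G.knot = (LongVirtual.i (LongVirtual.p G)).jones) ∧
      V LongVirtual.K₁ = LaurentPolynomial.T (-4) - LaurentPolynomial.T (-2)
        - LaurentPolynomial.T (-1) + 1 + LaurentPolynomial.T 1 ∧
      V LongVirtual.K₁ = V LongVirtual.K₂ ∧
      Vip LongVirtual.K₁ = V LongVirtual.K₁ ∧
      Vip LongVirtual.K₂ = LaurentPolynomial.invert (V LongVirtual.K₂) ∧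
      Vip LongVirtual.K₁ ≠ Vip LongVirtual.K₂ := by
  refine ⟨Quot.lift (fun G => (LongVirtual.pr G).jones) fun G H h => (LongVirtual.jones_move h).1,
    Quot.lift (fun G => (LongVirtual.i (LongVirtual.p G)).jones) fun G H h =>
      (LongVirtual.jones_move h).2, fun G => rfl, fun G => rfl, LongVirtual.jones_diagram₁,
    LongVirtual.jones_pr_diagram₂.symm, LongVirtual.jones_i_p_diagram₁,
    LongVirtual.jones_i_p_diagram₂, ?_⟩
  change (LongVirtual.i (LongVirtual.p LongVirtual.diagram₁)).jones ≠
    (LongVirtual.i (LongVirtual.p LongVirtual.diagram₂)).jones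
  rw [LongVirtual.jones_i_p_diagram₁, LongVirtual.jones_i_p_diagram₂, LongVirtual.jones_pr_diagram₂]
  exact LongVirtual.invert_jones_diagram₁_ne.symm
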